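/- Let $d\ge 1$ and consider $\mathbb Z^d$ with its nearest-neighbour graph, graph distance $d(\cdot,\cdot)$, and exterior boundary $\partial\Lambda=\{y\notin\Lambda: d(y,\Lambda)=1\}$. Let $(S,\mathscr S,\nu)$ be a probability space, $U:S\times S\to\mathbb R$ bounded, measurable and symmetric, and $W:S\to\mathbb R$ bounded and measurable. For finite $\Lambda\subset\mathbb Z^d$ and $\tau\in S^{\Lambda^c}$ let $\mu_\Lambda^\tau$ be the probability measure on $S^\Lambda$ with density $\frac1{Z_\Lambda^\tau}e^{-H_\Lambda^\tau}$ with respect to $\nu_\Lambda=\nu^{\otimes\Lambda}$, where $$H_\Lambda^\tau(\sigma)=-\sum_{xy\text{ edge},\ x,y\in\Lambda}U(\sigma_x,\sigma_y)-\sum_{xy\text{ edge},\ x\in\Lambda,\,y\in\partial\Lambda}U(\sigma_x,\tau_y)-\sum_{x\in\Lambda}W(\sigma_x).$$ For $\Delta\subset\Lambda$ let $$\psi_{\Lambda,\Delta}^\tau(\sigma_\Delta)=\frac1{Z_\Lambda^\tau}\int e^{-H_\Lambda^\tau(\eta_{\Lambda\setminus\Delta}\sigma_\Delta)}\,\nu_{\Lambda\setminus\Delta}(d\eta_{\Lambda\setminus\Delta})$$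 be the density of the marginal of $\mu_\Lambda^\tau$ on $S^\Delta$ with respect to $\nu_\Delta$. For $K,a>0$ the system satisfies $SM(K,a)$ if for all finite $\Lambda\subset\mathbb Z^d$, all $\Delta\subset\Lambda$, all $x\in\partial\Lambda$ and all $\tau,\tau'\in S^{\Lambda^c}$ with $\tau_y=\tau'_y$ for every $y\ne x$, $$\Big\|\frac{\psi_{\Lambda,\Delta}^{\tau'}}{\psi_{\Lambda,\Delta}^{\tau}}-1\Big\|_{L^\infty(\nu_\Delta)}\le K e^{-a\,d(x,\Delta)}.$$ Write $\mathrm{Ent}_V^\tau f=\mu_V^\tau[f\log(f/\mu_V^\tau f)]$; for $A\subset V$ let $\mathrm{Ent}_A f$ be the function on $S^V$ whose value at $\sigma$ is the entropy of $f$, as a function of the spins in $A$, with respect to the Gibbs measure in $A$ whose boundary condition is $\sigma$ on $V\setminus A$ and $\tau$ on $V^c$, the spins of $f$ in $V\setminus A$ being fixed to $\sigma$. Let $E$ and $O$ denote the sets of sites $x\in V$ with $\sum_i x_i$ even, respectively odd. For $k\in\mathbb N$ put $\ell_k=(3/2)^{k/d}$, and let $\mathbb F_k$ be the set of all finite $V\subset\mathbb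 Z^d$ that, up to translation and permutation of the coordinates, are contained in $[0,\ell_{k+1}]\times\dots\times[0,\ell_{k+d}]$. Let $\delta(k)$ be the largest constant $\delta>0$ such that $$\delta\,\mathrm{Ent}_V^\tau f\le\mu_V^\tau\big[\mathrm{Ent}_E f+\mathrm{Ent}_O f\big]$$ for all $V\in\mathbb F_k$, all $\tau\in S^{V^c}$ and all measurable $f:S^V\to[0,\infty)$ with $f\log^+f\in L^1(\mu_V^\tau)$ (formally, the supremum in $[0,\infty]$ of all such $\delta$, which is $+\infty$ in the degenerate case where $\nu$ only takes the values $0$ and $1$). **Theorem.** Let $d\ge1$ and $K,a>0$. For every $\varepsilon>0$ there is $k_0\in\mathbb N$, depending only on $K,a,d,\varepsilon$, such that for every spin system on $\mathbb Z^d$ as above that satisfies $SM(K,a)$, $$\delta(k)\ge\ell_k^{-\varepsilon}\qquad\text{for all }k\ge k_0 .$$ -/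

import Mathlib

open MeasureTheory
open scoped ENNReal

noncomputable section

/-! ### The lattice -/

/-- The vertices of the `d`-dimensional integer lattice. -/
abbrev Site (d : ℕ) : Type := Fin d → ℤ

/-- The distance of two sites, `∑ i, |x i - y i|`; it is the graph distance of the lattice
(see `latticeGraph_dist`). -/
def latticeDist {d : ℕ} (x y : Site d) : ℕ := ∑ i, (x i - y i).natAbs

lemma latticeDist_comm {d : ℕ} (x y : Site d) : latticeDist x y = latticeDist y x := by
  unfold latticeDist
  exact Finset.sum_congr rfl fun i _ => by omega

lemma latticeDist_self {d : ℕ} (x : Site d) : latticeDist x x = 0 := by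
  simp [latticeDist]

lemma latticeDist_triangle {d : ℕ} (x y z : Site d) :
    latticeDist x z ≤ latticeDist x y + latticeDist y z := by
  unfold latticeDist
  rw [← Finset.sum_add_distrib]
  exact Finset.sum_le_sum fun i _ => by omega

/-- The nearest neighbour graph: `x y` is an edge iff `∑ i, |x i - y i| = 1`. -/
def latticeGraph (d : ℕ) : SimpleGraph (Site d) where
  Adj x y := latticeDist x y = 1
  symm := ⟨fun x y h => by rw [latticeDist_comm]; exact h⟩
  loopless := ⟨fun x h => by simp [latticeDist_self] at h⟩

lemma latticeDist_le_length {d : ℕ} {x y : Site d} (p : (latticeGraph d).Walk x y) :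
    latticeDist x y ≤ p.length := by
  induction p with
  | nil => simp [latticeDist_self]
  | @cons u v w h p ih =>
    have h1 : latticeDist u v = 1 := h
    have h2 := latticeDist_triangle u v w
    rw [SimpleGraph.Walk.length_cons]
    omega

lemma exists_walk_length {d : ℕ} (y : Site d) : ∀ (n : ℕ) (x : Site d), latticeDist x y = n →
    ∃ p : (latticeGraph d).Walk x y, p.length = n := by
  intro n
  induction n with
  | zero =>
    intro x hx
    have hxy : x = y := by
      funext i
      have := (Finset.sum_eq_zero_iff.1 hx) i (Finset.mem_univ i)
      omega
    subst hxy
    exact ⟨SimpleGraph.Walk.nil, rfl⟩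
  | succ n ih =>
    intro x hx
    obtain ⟨i, hi⟩ : ∃ i, x i ≠ y i := by
      by_contra! hcon
      rw [funext hcon, latticeDist_self] at hx
      omega
    have key : ∃ c : ℤ, (x i - c).natAbs = 1 ∧ (x i - y i).natAbs = (c - y i).natAbs + 1 := by
      rcases lt_or_gt_of_ne hi with h | h
      · exact ⟨x i + 1, by omega, by omega⟩
      · exact ⟨x i - 1, by omega, by omega⟩
    obtain ⟨c, hc1, hc2⟩ := key
    have h1 : latticeDist x (Function.update x i c) = 1 := by
      unfold latticeDist
      rw [Finset.sum_eq_single i]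
      · simpa using hc1
      · intro j _ hj
        simp [Function.update_of_ne hj]
      · simp
    have h2 : latticeDist (Function.update x i c) y = n := by
      have e1 := Finset.add_sum_erase Finset.univ
        (fun j => (x j - y j).natAbs) (Finset.mem_univ i)
      have e2 := Finset.add_sum_erase Finset.univ
        (fun j => (Function.update x i c j - y j).natAbs) (Finset.mem_univ i)
      have e3 : ∑ j ∈ Finset.univ.erase i, (Function.update x i c j - y j).natAbs
          = ∑ j ∈ Finset.univ.erase i, (x j - y j).natAbs :=
        Finset.sum_congr rfl fun j hj => by
          rw [Function.update_of_ne (Finset.ne_of_mem_erase hj)]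
      simp only [Function.update_self] at e2
      unfold latticeDist at hx ⊢
      omega
    obtain ⟨p, hp⟩ := ih _ h2
    have hadj : (latticeGraph d).Adj x (Function.update x i c) := h1
    exact ⟨SimpleGraph.Walk.cons hadj p, by rw [SimpleGraph.Walk.length_cons, hp]⟩

/-- `latticeDist` is the graph distance of the lattice. -/
theorem latticeGraph_dist {d : ℕ} (x y : Site d) : (latticeGraph d).dist x y = latticeDist x y := by
  obtain ⟨p, hp⟩ := exists_walk_length y _ x rfl
  apply le_antisymm
  · rw [← hp]
    exact SimpleGraph.dist_le p
  · obtain ⟨q, hq⟩ := (SimpleGraph.Walk.reachable p).exists_walk_length_eq_dist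
    rw [← hq]
    exact latticeDist_le_length q

/-- The distance of a site from a (nonempty) set of sites. -/
def distToSet {d : ℕ} (x : Site d) (Δ : Finset (Site d)) : ℕ :=
  sInf ((latticeDist x) '' (Δ : Set (Site d)))

/-- The exterior boundary of a finite region: the sites outside at distance one from it
(see `mem_extBoundary`). -/
def extBoundary {d : ℕ} (Λ : Finset (Site d)) : Finset (Site d) :=
  (Λ.biUnion fun x => (Finset.Icc (x - 1) (x + 1)).filter fun y => latticeDist x y = 1) \ Λ

lemma mem_extBoundary {d : ℕ} {Λ : Finset (Site d)} {y : Site d} :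
    y ∈ extBoundary Λ ↔ y ∉ Λ ∧ ∃ x ∈ Λ, latticeDist x y = 1 := by
  have key : ∀ x : Site d, latticeDist x y = 1 → y ∈ Finset.Icc (x - 1) (x + 1) := by
    intro x h
    have hi : ∀ i, (x i - y i).natAbs ≤ 1 := fun i =>
      h ▸ Finset.single_le_sum (f := fun i => (x i - y i).natAbs)
        (fun _ _ => Nat.zero_le _) (Finset.mem_univ i)
    rw [Finset.mem_Icc]
    constructor <;> intro i <;> have := hi i <;>
      simp only [Pi.sub_apply, Pi.add_apply, Pi.one_apply] <;> omega
  simp only [extBoundary, Finset.mem_sdiff, Finset.mem_biUnion, Finset.mem_filter]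
  constructor
  · rintro ⟨⟨x, hx, -, h⟩, hy⟩
    exact ⟨hy, x, hx, h⟩
  · rintro ⟨hy, x, hx, h⟩
    exact ⟨⟨x, hx, key x h, h⟩, hy⟩

/-- The even sites of `V`. -/
def evenSites {d : ℕ} (V : Finset (Site d)) : Finset (Site d) := V.filter fun x => Even (∑ i, x i)

/-- The odd sites of `V`. -/
def oddSites {d : ℕ} (V : Finset (Site d)) : Finset (Site d) := V.filter fun x => Odd (∑ i, x i)

/-! ### Spin systems and Gibbs measures -/

/-- A spin system: a single spin probability space `(S, ν)`, a bounded measurable symmetric pair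
potential `U` and a bounded measurable single site potential `W`. -/
structure SpinSystem (S : Type*) [MeasurableSpace S] where
  ν : Measure S
  prob : IsProbabilityMeasure ν
  U : S → S → ℝ
  W : S → ℝ
  symm_U : ∀ s t, U s t = U t s
  measurable_U : Measurable (Function.uncurry U)
  measurable_W : Measurable W
  bounded_U : ∃ C : ℝ, ∀ s t, |U s t| ≤ C
  bounded_W : ∃ C : ℝ, ∀ s, |W s| ≤ C

/-- The configuration on the whole lattice that equals `σ` on `Λ` and `τ` outside `Λ`. -/
def patch {d : ℕ} {S : Type*} (Λ : Finset (Site d)) (τ : Site d → S) (σ : Λ → S) : Site d → S :=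
  fun x => if h : x ∈ Λ then σ ⟨x, h⟩ else τ x

namespace SpinSystem

variable {d : ℕ} {S : Type*} [MeasurableSpace S]

/-- The a priori product measure on `S ^ Λ`. -/
def refMeasure (P : SpinSystem S) (Λ : Finset (Site d)) : Measure (Λ → S) :=
  haveI := P.prob
  Measure.pi fun _ => P.ν

/-- The Hamiltonian of the region `Λ`, as a function of a configuration `ω` on the lattice, whose
restriction to `Λ` is the spin configuration and whose restriction to the complement is the
boundary condition. In the first sum every unordered edge inside `Λ` appears twice, whence the
factor `1 / 2`. -/
def hamiltonian (P : SpinSystem S) (Λ : Finset (Site d)) (ω : Site d → S) : ℝ :=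
  -((1 / 2 : ℝ) * ∑ x ∈ Λ, ∑ y ∈ Λ with latticeDist x y = 1, P.U (ω x) (ω y))
    - (∑ x ∈ Λ, ∑ y ∈ extBoundary Λ with latticeDist x y = 1, P.U (ω x) (ω y))
    - ∑ x ∈ Λ, P.W (ω x)

/-- The normalizing constant of the Gibbs measure in `Λ` with boundary condition `τ`. -/
def partitionFunction (P : SpinSystem S) (Λ : Finset (Site d)) (τ : Site d → S) : ℝ :=
  ∫ σ, Real.exp (-P.hamiltonian Λ (patch Λ τ σ)) ∂P.refMeasure Λ

/-- The Gibbs measure in `Λ` with boundary condition `τ`, of which only the values outside `Λ`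
matter. -/
def gibbs (P : SpinSystem S) (Λ : Finset (Site d)) (τ : Site d → S) : Measure (Λ → S) :=
  (P.refMeasure Λ).withDensity fun σ =>
    ENNReal.ofReal
      ((P.partitionFunction Λ τ)⁻¹ * Real.exp (-P.hamiltonian Λ (patch Λ τ σ)))

/-! ### Spatial mixing -/

/-- The density, with respect to the a priori measure on `S ^ Δ`, of the marginal on `Δ ⊆ Λ` of the
Gibbs measure in `Λ` with boundary condition `τ`. -/
def marginalDensity (P : SpinSystem S) (Λ Δ : Finset (Site d)) (τ : Site d → S) (σ : Δ → S) : ℝ :=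
  (P.partitionFunction Λ τ)⁻¹ *
    ∫ η, Real.exp (-P.hamiltonian Λ (patch Δ (patch (Λ \ Δ) τ η) σ)) ∂P.refMeasure (Λ \ Δ)

/-- The mixing condition in the region `Λ` with constants `K`, `a`. For `Δ = ∅` the density is
identically one and there is no constraint. -/
def MixingCondition (P : SpinSystem S) (Λ : Finset (Site d)) (K a : ℝ) : Prop :=
  ∀ Δ ⊆ Λ, ∀ x ∈ extBoundary Λ, ∀ τ τ' : Site d → S, (∀ y ∉ Λ, y ≠ x → τ y = τ' y) →
    eLpNorm (fun σ => P.marginalDensity Λ Δ τ' σ / P.marginalDensity Λ Δ τ σ - 1) ∞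
      (P.refMeasure Δ) ≤ ENNReal.ofReal (K * Real.exp (-a * distToSet x Δ))

/-- Strong spatial mixing `SM(K, a)` on the `d`-dimensional lattice. -/
def SM (P : SpinSystem S) (d : ℕ) (K a : ℝ) : Prop :=
  ∀ Λ : Finset (Site d), P.MixingCondition Λ K a

/-! ### Entropy and the even/odd factorization constant -/

/-- The entropy `μ[f log (f / μ[f])]`. -/
def entropy {Ω : Type*} [MeasurableSpace Ω] (μ : Measure Ω) (f : Ω → ℝ) : ℝ :=
  ∫ ω, f ω * Real.log (f ω / ∫ ω', f ω' ∂μ) ∂μ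

/-- For `A ⊆ V`, the function `Ent_A f` on `S ^ V`, when the boundary condition outside `V` is `τ`:
its value at `σ` is the entropy of `f` with respect to the Gibbs measure in `A` with boundary
condition equal to `σ` on `V \ A` and to `τ` outside `V`, the spins of `f` in `V \ A` being frozen
to `σ`. -/
def blockEntropy (P : SpinSystem S) (V A : Finset (Site d)) (τ : Site d → S) (f : (V → S) → ℝ)
    (σ : V → S) : ℝ :=
  entropy (P.gibbs A (patch V τ σ)) fun ξ => f fun x => patch A (patch V τ σ) ξ x

/-- The length scale `(3 / 2) ^ (k / d)`. -/
def scale (d k : ℕ) : ℝ := (3 / 2 : ℝ) ^ ((k : ℝ) / (d : ℝ))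

/-- `V` belongs to the `k`-th class of regions: up to a translation and a permutation of the
coordinates it is contained in `[0, ℓ_{k+1}] × ⋯ × [0, ℓ_{k+d}]`. -/
def InClass (k : ℕ) (V : Finset (Site d)) : Prop :=
  ∃ (π : Equiv.Perm (Fin d)) (v : Site d), ∀ x ∈ V, ∀ i : Fin d,
    0 ≤ x (π i) + v i ∧ ((x (π i) + v i : ℤ) : ℝ) ≤ scale d (k + (i + 1))

/-- The even/odd factorization of entropy with constant `δ` holds for all regions of the `k`-th
class, all boundary conditions, and all measurable `f ≥ 0` with `f log⁺ f` integrable. -/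
def EvenOddFactorization (P : SpinSystem S) (d k : ℕ) (δ : ℝ) : Prop :=
  ∀ V : Finset (Site d), InClass k V → ∀ (τ : Site d → S) (f : (V → S) → ℝ),
    Measurable f → (∀ σ, 0 ≤ f σ) →
    Integrable (fun σ => f σ * Real.posLog (f σ)) (P.gibbs V τ) →
    δ * entropy (P.gibbs V τ) f ≤
      ∫ σ, (P.blockEntropy V (evenSites V) τ f σ + P.blockEntropy V (oddSites V) τ f σ)
        ∂P.gibbs V τ

/-- The constant `δ(k)`: the largest `δ > 0` for which the even/odd factorization holds on the
`k`-th class. It takes values in `[0, ∞]`: it would be `0` if there were no such `δ`, and it is `∞`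
if all `δ` are admissible, which happens when `ν` takes only the values `0` and `1`. -/
def factorizationConstant (P : SpinSystem S) (d k : ℕ) : ℝ≥0∞ :=
  sSup (ENNReal.ofReal '' {δ : ℝ | 0 < δ ∧ P.EvenOddFactorization d k δ})

end SpinSystem

end

/-!
# Even/odd factorization of the entropy under strong spatial mixing

The kernel `gibbsKernel Λ` resamples the spins in `Λ` from the Gibbs measure with the current
boundary condition, and `kent κ F` is the entropy of `F` under a kernel `κ`. For functions bounded
above and away from zero all integrals are harmless, and `EntFac V C` states the even/odd
factorization in `V` with constant `1 / C`, simultaneously for all boundary conditions. Truncation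
and dominated convergence (`EntFac.entropy_le`) then give it for all `f` with `f log⁺ f ∈ L¹`.

Two facts drive the recursion.

* *Overlapping blocks* (`kent_le_of_overlap`). Let `V = A ∪ B`, with `V \ A` and `V \ B` at
  distance `r`. Averaging over `A ∩ B` leaves a function of the spins in `V \ A` and `V \ B`, and by
  strong mixing the joint law of these spins is comparable, up to powers of
  `(1 + K e^{-a r})^{|V|}`, to a product of two laws with frozen boundary conditions. Since the
  entropy is the minimum over `t` of the mean of a nonnegative function `entDiv (F ·) t`, it changes
  by at most the same factors, and it is subadditive for product measures. Hence `Ent_V F` is at most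
  a constant times the mean of `Ent_A F + Ent_B F`. With `A`, `B` the even and odd sites, this is the
  factorization itself, with a constant depending on `V` only through its cardinality.
* *Tensorization* (`EntFac.union`). In a union of mutually nonadjacent regions the Gibbs measure is a
  product, and by the chain rule and the convexity of the entropy the factorization constant of the
  union is the worst of those of the parts, however many there are.

A cube of side `4 M u` is covered by two families of slabs of width `4 u`, overlapping in such a way
that the complements of the two families are at distance `u`. Each family is a union of nonadjacent
slabs, so passing from width `4 M u` to `4 u` in one direction costs a constant factor independent
of `M`, provided `u` is so large that the mixing factor is bounded. Thus the constant is multiplied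
by at most `8 ^ d` when the side is multiplied by `M`, which yields a growth `ℓ ^ (d log 8 / log M)`;
the exponent is made small by the choice of `M`.
-/

noncomputable section

open ProbabilityTheory

/-! ### Entropy with respect to a Markov kernel -/

section KernelEntropy

variable {Ω : Type*} [MeasurableSpace Ω]

/-- Bounded measurable real functions. -/
def BddMeas (Φ : Ω → ℝ) : Prop := Measurable Φ ∧ ∃ M : ℝ, ∀ ω, |Φ ω| ≤ M

/-- Measurable functions with values in a compact subinterval of `(0, ∞)`. -/
def PosBdd (F : Ω → ℝ) : Prop :=
  Measurable F ∧ (∃ c : ℝ, 0 < c ∧ ∀ ω, c ≤ F ω) ∧ ∃ M : ℝ, ∀ ω, F ω ≤ M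

/-- The action of a kernel on functions. -/
def avg (κ : Kernel Ω Ω) (Φ : Ω → ℝ) (ω : Ω) : ℝ := ∫ ω', Φ ω' ∂κ ω

/-- The entropy of `F` with respect to the measures `κ ω`, as a function of `ω`, in the form
`κ (F log F) - κ F log (κ F)`. -/
def kent (κ : Kernel Ω Ω) (F : Ω → ℝ) (ω : Ω) : ℝ :=
  avg κ (fun ω' => F ω' * Real.log (F ω')) ω - avg κ F ω * Real.log (avg κ F ω)

/-- The Bregman divergence of `x ↦ x log x`; the entropy of `F` is the minimum over `t` of the
mean of `entDiv (F ·) t`. -/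
def entDiv (x t : ℝ) : ℝ := x * Real.log x - x * Real.log t - x + t

lemma entDiv_nonneg {x t : ℝ} (hx : 0 < x) (ht : 0 < t) : 0 ≤ entDiv x t := by
  have h := Real.log_le_sub_one_of_pos (div_pos ht hx)
  rw [Real.log_div ht.ne' hx.ne'] at h
  have h2 := mul_le_mul_of_nonneg_left h hx.le
  have h3 : x * (t / x - 1) = t - x := by field_simp
  unfold entDiv
  linarith [mul_sub x (Real.log t) (Real.log x)]

lemma BddMeas.integrable {Φ : Ω → ℝ} (h : BddMeas Φ) (m : Measure Ω) [IsFiniteMeasure m] :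
    Integrable Φ m := by
  obtain ⟨hm, M, hM⟩ := h
  exact Integrable.of_bound hm.aestronglyMeasurable M (Filter.Eventually.of_forall hM)

lemma BddMeas.add {Φ Ψ : Ω → ℝ} (h : BddMeas Φ) (h' : BddMeas Ψ) :
    BddMeas fun ω => Φ ω + Ψ ω := by
  obtain ⟨hm, M, hM⟩ := h
  obtain ⟨hm', M', hM'⟩ := h'
  exact ⟨hm.add hm', M + M', fun ω => (abs_add_le _ _).trans (add_le_add (hM ω) (hM' ω))⟩

lemma BddMeas.mul {Φ Ψ : Ω → ℝ} (h : BddMeas Φ) (h' : BddMeas Ψ) :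
    BddMeas fun ω => Φ ω * Ψ ω := by
  obtain ⟨hm, M, hM⟩ := h
  obtain ⟨hm', M', hM'⟩ := h'
  refine ⟨hm.mul hm', M * M', fun ω => ?_⟩
  rw [abs_mul]
  exact mul_le_mul (hM ω) (hM' ω) (abs_nonneg _) ((abs_nonneg _).trans (hM ω))

lemma BddMeas.const (c : ℝ) : BddMeas fun _ : Ω => c :=
  ⟨measurable_const, |c|, fun _ => le_rfl⟩

lemma BddMeas.sub {Φ Ψ : Ω → ℝ} (h : BddMeas Φ) (h' : BddMeas Ψ) :
    BddMeas fun ω => Φ ω - Ψ ω := by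
  have := h.add ((BddMeas.const (-1)).mul h')
  simpa [sub_eq_add_neg] using this

lemma PosBdd.bddMeas {F : Ω → ℝ} (h : PosBdd F) : BddMeas F := by
  obtain ⟨hm, ⟨c, hc, hF⟩, M, hM⟩ := h
  exact ⟨hm, M, fun ω => by rw [abs_of_pos (hc.trans_le (hF ω))]; exact hM ω⟩

lemma PosBdd.pos {F : Ω → ℝ} (h : PosBdd F) (ω : Ω) : 0 < F ω := by
  obtain ⟨hm, ⟨c, hc, hF⟩, -⟩ := h
  exact hc.trans_le (hF ω)

lemma PosBdd.log {F : Ω → ℝ} (h : PosBdd F) : BddMeas fun ω => Real.log (F ω) := by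
  obtain ⟨hm, ⟨c, hc, hF⟩, M, hM⟩ := h
  refine ⟨hm.log, max (-Real.log c) (Real.log M), fun ω => abs_le'.2 ⟨?_, ?_⟩⟩
  · exact le_max_of_le_right (Real.log_le_log (hc.trans_le (hF ω)) (hM ω))
  · exact le_max_of_le_left (neg_le_neg (Real.log_le_log hc (hF ω)))

lemma PosBdd.mul_log {F : Ω → ℝ} (h : PosBdd F) : BddMeas fun ω => F ω * Real.log (F ω) :=
  h.bddMeas.mul h.log

lemma PosBdd.entDiv {F : Ω → ℝ} (h : PosBdd F) (t : ℝ) : BddMeas fun ω => entDiv (F ω) t :=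
  ((h.mul_log.sub (h.bddMeas.mul (BddMeas.const _))).sub h.bddMeas).add (BddMeas.const _)

variable {κ κ₁ κ₂ η : Kernel Ω Ω}

lemma avg_mul_const {Φ : Ω → ℝ} (c : ℝ) (ω : Ω) :
    avg κ (fun ω => Φ ω * c) ω = avg κ Φ ω * c :=
  integral_mul_const _ _

lemma avg_const_mul {Φ : Ω → ℝ} (c : ℝ) (ω : Ω) :
    avg κ (fun ω => c * Φ ω) ω = c * avg κ Φ ω :=
  integral_const_mul _ _

lemma avg_nonneg {Φ : Ω → ℝ} (hle : ∀ ω, 0 ≤ Φ ω) (ω : Ω) : 0 ≤ avg κ Φ ω :=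
  integral_nonneg hle

variable [IsMarkovKernel κ] [IsMarkovKernel κ₁] [IsMarkovKernel κ₂] [IsMarkovKernel η]

lemma avg_add {Φ Ψ : Ω → ℝ} (h : BddMeas Φ) (h' : BddMeas Ψ) (ω : Ω) :
    avg κ (fun ω => Φ ω + Ψ ω) ω = avg κ Φ ω + avg κ Ψ ω :=
  integral_add (h.integrable _) (h'.integrable _)

lemma avg_sub {Φ Ψ : Ω → ℝ} (h : BddMeas Φ) (h' : BddMeas Ψ) (ω : Ω) :
    avg κ (fun ω => Φ ω - Ψ ω) ω = avg κ Φ ω - avg κ Ψ ω :=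
  integral_sub (h.integrable _) (h'.integrable _)

lemma avg_const (c : ℝ) (ω : Ω) : avg κ (fun _ => c) ω = c := by
  simp [avg]

lemma avg_mono {Φ Ψ : Ω → ℝ} (h : BddMeas Φ) (h' : BddMeas Ψ) (hle : ∀ ω, Φ ω ≤ Ψ ω) (ω : Ω) :
    avg κ Φ ω ≤ avg κ Ψ ω :=
  integral_mono (h.integrable _) (h'.integrable _) hle

lemma BddMeas.avg {Φ : Ω → ℝ} (h : BddMeas Φ) : BddMeas (avg κ Φ) := by
  obtain ⟨hm, M, hM⟩ := h
  refine ⟨(hm.stronglyMeasurable.integral_kernel (κ := κ)).measurable, M, fun ω => ?_⟩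
  have := norm_integral_le_of_norm_le_const (μ := κ ω) (f := Φ) (C := M)
    (Filter.Eventually.of_forall hM)
  simpa [_root_.avg] using this

lemma PosBdd.avg {F : Ω → ℝ} (h : PosBdd F) : PosBdd (avg κ F) := by
  have hb := h.bddMeas
  obtain ⟨hm, ⟨c, hc, hF⟩, M, hM⟩ := h
  refine ⟨hb.avg.1, ⟨c, hc, fun ω => ?_⟩, M, fun ω => ?_⟩
  · rw [← avg_const (κ := κ) c ω]
    exact avg_mono (BddMeas.const _) hb hF ω
  · rw [← avg_const (κ := κ) M ω]
    exact avg_mono hb (BddMeas.const _) hM ω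

lemma PosBdd.kent {F : Ω → ℝ} (h : PosBdd F) : BddMeas (kent κ F) :=
  h.mul_log.avg.sub h.avg.mul_log

lemma avg_avg {Φ : Ω → ℝ} (h : BddMeas Φ) : avg κ (avg η Φ) = avg (η ∘ₖ κ) Φ := by
  ext ω
  exact (Kernel.integral_comp (h.integrable _)).symm

lemma avg_entDiv {F : Ω → ℝ} (h : PosBdd F) (t : ℝ) (ω : Ω) :
    avg κ (fun ω' => entDiv (F ω') t) ω = kent κ F ω + entDiv (avg κ F ω) t := by
  unfold entDiv
  rw [avg_add ((h.mul_log.sub (h.bddMeas.mul (BddMeas.const _))).sub h.bddMeas) (BddMeas.const _),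
    avg_sub (h.mul_log.sub (h.bddMeas.mul (BddMeas.const _))) h.bddMeas,
    avg_sub h.mul_log (h.bddMeas.mul (BddMeas.const _)), avg_const, avg_mul_const, kent]
  ring

/-- The mean of `entDiv (F ·) t` bounds the entropy for every `t`. -/
lemma kent_le_avg_entDiv {F : Ω → ℝ} (h : PosBdd F) {t : ℝ} (ht : 0 < t) (ω : Ω) :
    kent κ F ω ≤ avg κ (fun ω' => entDiv (F ω') t) ω := by
  rw [avg_entDiv h]
  linarith [entDiv_nonneg ((h.avg (κ := κ)).pos ω) ht]

lemma kent_eq_avg_entDiv {F : Ω → ℝ} (h : PosBdd F) (ω : Ω) :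
    kent κ F ω = avg κ (fun ω' => entDiv (F ω') (avg κ F ω)) ω := by
  rw [avg_entDiv h]
  simp [entDiv]

lemma kent_nonneg {F : Ω → ℝ} (h : PosBdd F) (ω : Ω) : 0 ≤ kent κ F ω := by
  rw [kent_eq_avg_entDiv h]
  exact avg_nonneg (fun ω' => entDiv_nonneg (h.pos ω') (h.avg.pos ω)) ω

/-- The chain rule for the entropy. -/
lemma kent_comp {F : Ω → ℝ} (h : PosBdd F) (ω : Ω) :
    kent (η ∘ₖ κ) F ω = avg κ (kent η F) ω + kent κ (avg η F) ω := by
  have e : avg κ (kent η F) ω = avg κ (avg η fun ω' => F ω' * Real.log (F ω')) ω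
      - avg κ (fun ω' => avg η F ω' * Real.log (avg η F ω')) ω :=
    avg_sub h.mul_log.avg h.avg.mul_log ω
  rw [e, avg_avg h.mul_log]
  unfold kent
  rw [avg_avg h.bddMeas]
  ring

lemma kent_chain (hcomp : η ∘ₖ κ = κ) {F : Ω → ℝ} (h : PosBdd F) (ω : Ω) :
    kent κ F ω = avg κ (kent η F) ω + kent κ (avg η F) ω := by
  rw [← kent_comp h, hcomp]

/-- Entropy with respect to a coarser kernel is larger. -/
lemma avg_kent_le_kent (hcomp : η ∘ₖ κ = κ) {F : Ω → ℝ} (h : PosBdd F) (ω : Ω) :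
    avg κ (kent η F) ω ≤ kent κ F ω := by
  rw [kent_chain hcomp h]
  linarith [kent_nonneg (κ := κ) (h.avg (κ := η)) ω]

/-- The log-sum inequality. -/
lemma log_sum_le {F H : Ω → ℝ} (hF : PosBdd F) (hH : PosBdd H) (ω : Ω) :
    avg κ F ω * Real.log (avg κ F ω) - avg κ F ω * Real.log (avg κ H ω) ≤
      avg κ (fun ω' => F ω' * Real.log (F ω')) ω
        - avg κ (fun ω' => F ω' * Real.log (H ω')) ω := by
  set g := avg κ F ω with hg
  set h := avg κ H ω with hh
  have gpos : 0 < g := hF.avg.pos ω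
  have hpos : 0 < h := hH.avg.pos ω
  have hb : BddMeas fun ω' => F ω' * Real.log (H ω') := hF.bddMeas.mul hH.log
  have key : 0 ≤ avg κ (fun ω' => ((F ω' * Real.log (F ω') - F ω' * Real.log (H ω'))
      - F ω' * (Real.log g - Real.log h + 1)) + H ω' * (g / h)) ω := by
    refine avg_nonneg (fun ω' => ?_) ω
    have h1 := entDiv_nonneg (hF.pos ω') (mul_pos (hH.pos ω') (div_pos gpos hpos))
    unfold entDiv at h1
    rw [Real.log_mul (hH.pos ω').ne' (div_pos gpos hpos).ne',
      Real.log_div gpos.ne' hpos.ne'] at h1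
    linarith
  rw [avg_add ((hF.mul_log.sub hb).sub (hF.bddMeas.mul (BddMeas.const _)))
      (hH.bddMeas.mul (BddMeas.const _)),
    avg_sub (hF.mul_log.sub hb) (hF.bddMeas.mul (BddMeas.const _)),
    avg_sub hF.mul_log hb, avg_mul_const, avg_mul_const, ← hg, ← hh,
    mul_div_cancel₀ _ hpos.ne'] at key
  linarith

/-- A kernel is proper if it does not see the functions in its own range, as is the case for a
kernel that resamples part of a configuration: factors `log (κ G)` can be pulled out. -/
def IsProper (κ : Kernel Ω Ω) : Prop :=
  ∀ Φ G : Ω → ℝ, BddMeas Φ → PosBdd G →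
    ∀ ω, avg κ (fun ω' => Φ ω' * Real.log (avg κ G ω')) ω = avg κ Φ ω * Real.log (avg κ G ω)

/-- Convexity of the entropy: averaging with respect to a commuting kernel decreases the
entropy. -/
lemma kent_avg_le (hcomm : κ₁ ∘ₖ κ₂ = κ₂ ∘ₖ κ₁) (hprop : IsProper κ₂) {F : Ω → ℝ}
    (hF : PosBdd F) (ω : Ω) : kent κ₂ (avg κ₁ F) ω ≤ avg κ₁ (kent κ₂ F) ω := by
  have hH : PosBdd (avg κ₂ F) := hF.avg
  have hg : PosBdd (avg κ₁ F) := hF.avg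
  have hcomm' : ∀ {Φ : Ω → ℝ}, BddMeas Φ → avg κ₂ (avg κ₁ Φ) = avg κ₁ (avg κ₂ Φ) := by
    intro Φ hΦ
    rw [avg_avg hΦ, avg_avg hΦ, hcomm]
  have hFH : BddMeas fun ω' => F ω' * Real.log (avg κ₂ F ω') := hF.bddMeas.mul hH.log
  have hgh : BddMeas fun ω' => avg κ₁ F ω' * Real.log (avg κ₁ (avg κ₂ F) ω') :=
    hg.bddMeas.mul hH.avg.log
  have step := avg_mono (κ := κ₂) (hg.mul_log.sub hgh) (hF.mul_log.avg.sub hFH.avg)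
    (fun ω' => log_sum_le (κ := κ₁) hF hH ω') ω
  rw [avg_sub hg.mul_log hgh, avg_sub hF.mul_log.avg hFH.avg, hcomm' hF.mul_log, hcomm' hFH,
    ← hcomm' hF.bddMeas, hprop _ _ hg.bddMeas hg] at step
  have e1 : avg κ₂ (fun ω' => F ω' * Real.log (avg κ₂ F ω'))
      = fun ω' => avg κ₂ F ω' * Real.log (avg κ₂ F ω') :=
    funext fun ω' => hprop _ _ hF.bddMeas hF ω'
  rw [e1] at step
  have e2 : avg κ₁ (kent κ₂ F) ω = avg κ₁ (avg κ₂ fun ω' => F ω' * Real.log (F ω')) ω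
      - avg κ₁ (fun ω' => avg κ₂ F ω' * Real.log (avg κ₂ F ω')) ω :=
    avg_sub hF.mul_log.avg hH.mul_log ω
  rw [e2, kent]
  linarith

end KernelEntropy

/-! ### Gibbs measures as kernels on configurations -/

section Configurations

variable {d : ℕ} {S : Type*}

/-- `Φ` does not depend on the spins in `Λ`. -/
def IndepOf {β : Type*} (Λ : Finset (Site d)) (Φ : (Site d → S) → β) : Prop :=
  ∀ ω ω' : Site d → S, (∀ x ∉ Λ, ω x = ω' x) → Φ ω = Φ ω'

lemma IndepOf.mono {β : Type*} {A B : Finset (Site d)} {Φ : (Site d → S) → β}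
    (h : IndepOf B Φ) (hAB : A ⊆ B) : IndepOf A Φ :=
  fun ω ω' hω => h ω ω' fun x hx => hω x fun hx' => hx (hAB hx')

/-- Independence of two blocks is independence of their union. -/
lemma IndepOf.union {β : Type*} {A B : Finset (Site d)} {Φ : (Site d → S) → β}
    (hA : IndepOf A Φ) (hB : IndepOf B Φ) : IndepOf (A ∪ B) Φ := by
  intro ω ω' h
  have h1 := hA ω (fun x => if x ∈ A then ω' x else ω x) fun x hx => by simp [hx]
  have h2 := hB (fun x => if x ∈ A then ω' x else ω x) ω' fun x hx => by
    by_cases hxA : x ∈ A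
    · simp [hxA]
    · simpa [hxA] using h x (by simp [hxA, hx])
  exact h1.trans h2

lemma patch_of_mem {Λ : Finset (Site d)} (τ : Site d → S) (σ : Λ → S) {x : Site d} (h : x ∈ Λ) :
    patch Λ τ σ x = σ ⟨x, h⟩ := dif_pos h

lemma patch_of_notMem {Λ : Finset (Site d)} (τ : Site d → S) (σ : Λ → S) {x : Site d}
    (h : x ∉ Λ) : patch Λ τ σ x = τ x := dif_neg h

lemma patch_congr {Λ : Finset (Site d)} {τ τ' : Site d → S} (h : ∀ x ∉ Λ, τ x = τ' x)
    (σ : Λ → S) : patch Λ τ σ = patch Λ τ' σ := by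
  funext x
  by_cases hx : x ∈ Λ
  · rw [patch_of_mem _ _ hx, patch_of_mem _ _ hx]
  · rw [patch_of_notMem _ _ hx, patch_of_notMem _ _ hx, h x hx]

lemma IndepOf.apply_patch {β : Type*} {Λ : Finset (Site d)} {Φ : (Site d → S) → β}
    (h : IndepOf Λ Φ) (ω : Site d → S) (σ : Λ → S) : Φ (patch Λ ω σ) = Φ ω :=
  h _ _ fun _ hx => patch_of_notMem _ _ hx

variable [MeasurableSpace S]

lemma measurable_patch_prod (Λ : Finset (Site d)) :
    Measurable fun p : (Site d → S) × (Λ → S) => patch Λ p.1 p.2 :=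
  measurable_updateFinset'

lemma measurable_patch (Λ : Finset (Site d)) (τ : Site d → S) : Measurable (patch Λ τ) :=
  measurable_updateFinset

end Configurations

namespace SpinSystem

variable {d : ℕ} {S : Type*} [MeasurableSpace S] (P : SpinSystem S)

instance isProbabilityMeasure_ν : IsProbabilityMeasure P.ν := P.prob

instance isProbabilityMeasure_refMeasure (Λ : Finset (Site d)) :
    IsProbabilityMeasure (P.refMeasure Λ) := by
  unfold refMeasure
  infer_instance

/-- The interaction between two sets of sites; edges with both ends in `X ∩ Y` count twice. -/
def edgeSum (X Y : Finset (Site d)) (ω : Site d → S) : ℝ :=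
  ∑ x ∈ X, ∑ y ∈ Y with latticeDist x y = 1, P.U (ω x) (ω y)

lemma hamiltonian_eq (Λ : Finset (Site d)) (ω : Site d → S) :
    P.hamiltonian Λ ω = -(1 / 2 * P.edgeSum Λ Λ ω) - P.edgeSum Λ (extBoundary Λ) ω
      - ∑ x ∈ Λ, P.W (ω x) := rfl

lemma edgeSum_union_left {X X' : Finset (Site d)} (h : Disjoint X X') (Y : Finset (Site d))
    (ω : Site d → S) : P.edgeSum (X ∪ X') Y ω = P.edgeSum X Y ω + P.edgeSum X' Y ω :=
  Finset.sum_union h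

lemma edgeSum_union_right (X : Finset (Site d)) {Y Y' : Finset (Site d)} (h : Disjoint Y Y')
    (ω : Site d → S) : P.edgeSum X (Y ∪ Y') ω = P.edgeSum X Y ω + P.edgeSum X Y' ω := by
  unfold edgeSum
  rw [← Finset.sum_add_distrib]
  refine Finset.sum_congr rfl fun x _ => ?_
  rw [Finset.filter_union, Finset.sum_union (Finset.disjoint_filter_filter h)]

lemma edgeSum_comm (X Y : Finset (Site d)) (ω : Site d → S) :
    P.edgeSum X Y ω = P.edgeSum Y X ω := by
  unfold edgeSum
  simp_rw [Finset.sum_filter]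
  rw [Finset.sum_comm]
  refine Finset.sum_congr rfl fun y _ => Finset.sum_congr rfl fun x _ => ?_
  rw [latticeDist_comm, P.symm_U]

lemma edgeSum_congr {X Y : Finset (Site d)} {ω ω' : Site d → S} (hX : ∀ x ∈ X, ω x = ω' x)
    (hY : ∀ y ∈ Y, ω y = ω' y) : P.edgeSum X Y ω = P.edgeSum X Y ω' :=
  Finset.sum_congr rfl fun x hx => Finset.sum_congr rfl fun y hy => by
    rw [hX x hx, hY y (Finset.mem_filter.1 hy).1]

lemma hamiltonian_congr {Λ : Finset (Site d)} {ω ω' : Site d → S} (h : ∀ x ∈ Λ, ω x = ω' x)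
    (h' : ∀ x ∈ extBoundary Λ, ω x = ω' x) : P.hamiltonian Λ ω = P.hamiltonian Λ ω' := by
  rw [hamiltonian_eq, hamiltonian_eq, P.edgeSum_congr h h, P.edgeSum_congr h h',
    Finset.sum_congr rfl fun x hx => by rw [h x hx]]

/-- The difference of the energies in `V` and in `A ⊆ V` does not involve the spins in `A`. -/
lemma indepOf_hamiltonian_sub {A V : Finset (Site d)} (h : A ⊆ V) :
    IndepOf A fun ω : Site d → S => P.hamiltonian V ω - P.hamiltonian A ω := by
  have hd : Disjoint A (V \ A) := Finset.disjoint_sdiff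
  have hV : V = A ∪ V \ A := (Finset.union_sdiff_of_subset h).symm
  have hb : ∀ ω : Site d → S, P.edgeSum A (extBoundary A) ω
      = P.edgeSum A (V \ A) ω + P.edgeSum A (extBoundary V) ω := by
    intro ω
    have hdisj : Disjoint (V \ A) (extBoundary V) := by
      rw [Finset.disjoint_left]
      intro y hy hy'
      exact (mem_extBoundary.1 hy').1 (Finset.mem_sdiff.1 hy).1
    rw [← edgeSum_union_right _ _ hdisj]
    refine Finset.sum_congr rfl fun x hx => Finset.sum_congr ?_ fun _ _ => rfl
    ext y
    simp only [Finset.mem_filter, Finset.mem_union, Finset.mem_sdiff, mem_extBoundary]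
    constructor
    · rintro ⟨⟨hyA, -⟩, hxy⟩
      by_cases hyV : y ∈ V
      · exact ⟨Or.inl ⟨hyV, hyA⟩, hxy⟩
      · exact ⟨Or.inr ⟨hyV, x, h hx, hxy⟩, hxy⟩
    · rintro ⟨⟨-, hyA⟩ | ⟨hyV, -⟩, hxy⟩
      · exact ⟨⟨hyA, x, hx, hxy⟩, hxy⟩
      · exact ⟨⟨fun hyA => hyV (h hyA), x, hx, hxy⟩, hxy⟩
  have key : ∀ ω : Site d → S, P.hamiltonian V ω - P.hamiltonian A ω
      = -(1 / 2 * P.edgeSum (V \ A) (V \ A) ω) - P.edgeSum (V \ A) (extBoundary V) ω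
        - ∑ x ∈ V \ A, P.W (ω x) := by
    intro ω
    have e1 : P.edgeSum V V ω = P.edgeSum A A ω + 2 * P.edgeSum A (V \ A) ω
        + P.edgeSum (V \ A) (V \ A) ω := by
      conv_lhs => rw [hV]
      rw [edgeSum_union_left _ hd, edgeSum_union_right _ _ hd, edgeSum_union_right _ _ hd,
        P.edgeSum_comm (V \ A) A]
      ring
    have e2 : P.edgeSum V (extBoundary V) ω = P.edgeSum A (extBoundary V) ω
        + P.edgeSum (V \ A) (extBoundary V) ω := by
      rw [← edgeSum_union_left _ hd, ← hV]
    have e3 : ∑ x ∈ V, P.W (ω x) = ∑ x ∈ A, P.W (ω x) + ∑ x ∈ V \ A, P.W (ω x) := by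
      rw [← Finset.sum_union hd, ← hV]
    rw [hamiltonian_eq, hamiltonian_eq, e1, e2, e3, hb]
    ring
  intro ω ω' hω
  have h1 : ∀ x ∈ V \ A, ω x = ω' x := fun x hx => hω x (Finset.mem_sdiff.1 hx).2
  have h2 : ∀ x ∈ extBoundary V, ω x = ω' x := fun x hx =>
    hω x fun hxA => (mem_extBoundary.1 hx).1 (h hxA)
  simp only [key]
  rw [P.edgeSum_congr h1 h1, P.edgeSum_congr h1 h2,
    Finset.sum_congr rfl fun x hx => by rw [h1 x hx]]

lemma measurable_hamiltonian (Λ : Finset (Site d)) :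
    Measurable (P.hamiltonian Λ : (Site d → S) → ℝ) := by
  have hU : ∀ x y : Site d, Measurable fun ω : Site d → S => P.U (ω x) (ω y) := fun x y =>
    P.measurable_U.comp (f := fun ω : Site d → S => (ω x, ω y))
      ((measurable_pi_apply x).prodMk (measurable_pi_apply y))
  have hW : ∀ x : Site d, Measurable fun ω : Site d → S => P.W (ω x) := fun x =>
    P.measurable_W.comp (measurable_pi_apply x)
  unfold hamiltonian
  fun_prop

lemma exists_abs_hamiltonian_le (Λ : Finset (Site d)) :
    ∃ C : ℝ, ∀ ω : Site d → S, |P.hamiltonian Λ ω| ≤ C := by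
  obtain ⟨C, hC⟩ := P.bounded_U
  obtain ⟨D, hD⟩ := P.bounded_W
  have he : ∀ (X Y : Finset (Site d)) (ω : Site d → S), |P.edgeSum X Y ω|
      ≤ ∑ x ∈ X, ∑ _y ∈ Y with latticeDist x _y = 1, C := fun X Y ω =>
    (Finset.abs_sum_le_sum_abs _ _).trans (Finset.sum_le_sum fun x _ =>
      (Finset.abs_sum_le_sum_abs _ _).trans (Finset.sum_le_sum fun y _ => hC _ _))
  refine ⟨1 / 2 * (∑ x ∈ Λ, ∑ _y ∈ Λ with latticeDist x _y = 1, C)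
    + (∑ x ∈ Λ, ∑ _y ∈ extBoundary Λ with latticeDist x _y = 1, C) + ∑ x ∈ Λ, D, fun ω => ?_⟩
  have h1 := abs_le.1 (he Λ Λ ω)
  have h2 := abs_le.1 (he Λ (extBoundary Λ) ω)
  have h3 : |∑ x ∈ Λ, P.W (ω x)| ≤ ∑ x ∈ Λ, D :=
    (Finset.abs_sum_le_sum_abs _ _).trans (Finset.sum_le_sum fun x _ => hD _)
  have h3 := abs_le.1 h3
  rw [hamiltonian_eq, abs_le]
  constructor <;> linarith [h1.1, h1.2, h2.1, h2.2, h3.1, h3.2]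

/-- The Boltzmann weight `exp (-H)`. -/
def weight (Λ : Finset (Site d)) (ω : Site d → S) : ℝ≥0∞ :=
  ENNReal.ofReal (Real.exp (-P.hamiltonian Λ ω))

lemma measurable_weight (Λ : Finset (Site d)) :
    Measurable (P.weight Λ : (Site d → S) → ℝ≥0∞) := by
  have := P.measurable_hamiltonian Λ
  unfold weight
  fun_prop

/-- Integration of the spins in `Λ` with respect to the a priori measure. -/
def marg (Λ : Finset (Site d)) (F : (Site d → S) → ℝ≥0∞) : (Site d → S) → ℝ≥0∞ :=
  lmarginal (fun _ => P.ν) Λ F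

lemma marg_apply (Λ : Finset (Site d)) (F : (Site d → S) → ℝ≥0∞) (ω : Site d → S) :
    P.marg Λ F ω = ∫⁻ σ, F (patch Λ ω σ) ∂P.refMeasure Λ := rfl

lemma measurable_marg (Λ : Finset (Site d)) {F : (Site d → S) → ℝ≥0∞} (hF : Measurable F) :
    Measurable (P.marg Λ F) :=
  Measurable.lmarginal (fun _ => P.ν) hF

lemma indepOf_marg (Λ : Finset (Site d)) (F : (Site d → S) → ℝ≥0∞) : IndepOf Λ (P.marg Λ F) :=
  fun _ _ h => lmarginal_congr (fun _ => P.ν) F h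

lemma marg_mul_of_indepOf {Λ : Finset (Site d)} {c F : (Site d → S) → ℝ≥0∞} (hc : IndepOf Λ c)
    (hF : Measurable F) (ω : Site d → S) :
    P.marg Λ (fun ω => c ω * F ω) ω = c ω * P.marg Λ F ω := by
  simp only [marg_apply, hc.apply_patch]
  exact lintegral_const_mul _ (hF.comp (measurable_patch Λ ω))

lemma marg_bounds {Λ Δ : Finset (Site d)} (ω : Site d → S) :
    P.marg Δ (P.weight Λ) ω ≠ 0 ∧ P.marg Δ (P.weight Λ) ω ≠ ∞ := by
  obtain ⟨C, hC⟩ := P.exists_abs_hamiltonian_le (Λ := Λ)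
  constructor
  · have : ∫⁻ _σ, ENNReal.ofReal (Real.exp (-C)) ∂P.refMeasure Δ ≤ P.marg Δ (P.weight Λ) ω :=
      lintegral_mono fun σ => ENNReal.ofReal_le_ofReal (Real.exp_le_exp.2
        (neg_le_neg (abs_le.1 (hC _)).2))
    rw [lintegral_const, measure_univ, mul_one] at this
    exact (lt_of_lt_of_le (ENNReal.ofReal_pos.2 (Real.exp_pos _)) this).ne'
  · have : P.marg Δ (P.weight Λ) ω ≤ ∫⁻ _σ, ENNReal.ofReal (Real.exp C) ∂P.refMeasure Δ :=
      lintegral_mono fun σ => ENNReal.ofReal_le_ofReal (Real.exp_le_exp.2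
        (neg_le.1 (abs_le.1 (hC _)).1))
    rw [lintegral_const, measure_univ, mul_one] at this
    exact (this.trans_lt ENNReal.ofReal_lt_top).ne

lemma integral_exp_eq_toReal_marg (Λ Δ : Finset (Site d)) (ω : Site d → S) :
    ∫ σ, Real.exp (-P.hamiltonian Λ (patch Δ ω σ)) ∂P.refMeasure Δ
      = (P.marg Δ (P.weight Λ) ω).toReal := by
  have hm : Measurable fun σ => Real.exp (-P.hamiltonian Λ (patch Δ ω σ)) :=
    ((P.measurable_hamiltonian Λ).comp (measurable_patch Δ ω)).neg.exp
  rw [integral_eq_lintegral_of_nonneg_ae (Filter.Eventually.of_forall fun _ => (Real.exp_pos _).le)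
    hm.aestronglyMeasurable]
  rfl

lemma ofReal_gibbs_density (Λ : Finset (Site d)) (ω : Site d → S) (r : ℝ≥0∞) (hr : r ≠ ∞) :
    ENNReal.ofReal ((P.partitionFunction Λ ω)⁻¹ * r.toReal)
      = (P.marg Λ (P.weight Λ) ω)⁻¹ * r := by
  have hb := P.marg_bounds (Λ := Λ) (Δ := Λ) ω
  have hZ : P.partitionFunction Λ ω = (P.marg Λ (P.weight Λ) ω).toReal :=
    P.integral_exp_eq_toReal_marg Λ Λ ω
  rw [hZ, ENNReal.ofReal_mul (inv_nonneg.2 ENNReal.toReal_nonneg),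
    ENNReal.ofReal_inv_of_pos (ENNReal.toReal_pos hb.1 hb.2), ENNReal.ofReal_toReal hb.2,
    ENNReal.ofReal_toReal hr]

lemma lintegral_gibbs (Λ : Finset (Site d)) (ω : Site d → S) {f : (Λ → S) → ℝ≥0∞}
    (hf : Measurable f) : ∫⁻ σ, f σ ∂P.gibbs Λ ω
      = (P.marg Λ (P.weight Λ) ω)⁻¹ *
        ∫⁻ σ, f σ * P.weight Λ (patch Λ ω σ) ∂P.refMeasure Λ := by
  have hm : Measurable fun σ => P.weight Λ (patch Λ ω σ) :=
    (P.measurable_weight Λ).comp (measurable_patch Λ ω)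
  have hdens : (fun σ => ENNReal.ofReal ((P.partitionFunction Λ ω)⁻¹ *
      Real.exp (-P.hamiltonian Λ (patch Λ ω σ))))
      = fun σ => (P.marg Λ (P.weight Λ) ω)⁻¹ * P.weight Λ (patch Λ ω σ) := by
    funext σ
    rw [weight, ← P.ofReal_gibbs_density Λ ω _ ENNReal.ofReal_ne_top,
      ENNReal.toReal_ofReal (Real.exp_pos _).le]
  rw [gibbs, hdens, lintegral_withDensity_eq_lintegral_mul _ (hm.const_mul _) hf,
    ← lintegral_const_mul (f := fun σ => f σ * P.weight Λ (patch Λ ω σ)) _ (hf.mul hm)]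
  refine lintegral_congr fun σ => ?_
  simp only [Pi.mul_apply]
  ring

instance isProbabilityMeasure_gibbs (Λ : Finset (Site d)) (ω : Site d → S) :
    IsProbabilityMeasure (P.gibbs Λ ω) := by
  refine ⟨?_⟩
  have hb := P.marg_bounds (Λ := Λ) (Δ := Λ) ω
  rw [← lintegral_one, P.lintegral_gibbs Λ ω measurable_const]
  simp only [one_mul]
  exact ENNReal.inv_mul_cancel hb.1 hb.2

/-- The kernel that resamples the spins in `Λ` from the Gibbs measure with the current boundary
condition. -/
def gibbsKernel (Λ : Finset (Site d)) : Kernel (Site d → S) (Site d → S) where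
  toFun ω := (P.gibbs Λ ω).map (patch Λ ω)
  measurable' := by
    refine Measure.measurable_of_measurable_coe _ fun s hs => ?_
    have h1 : ∀ ω : Site d → S, (P.gibbs Λ ω).map (patch Λ ω) s
        = (P.marg Λ (P.weight Λ) ω)⁻¹
          * P.marg Λ (fun ω => s.indicator 1 ω * P.weight Λ ω) ω := by
      intro ω
      rw [← lintegral_indicator_one hs, lintegral_map (measurable_one.indicator hs)
        (measurable_patch Λ ω), P.lintegral_gibbs Λ ω (f := fun σ => s.indicator 1 (patch Λ ω σ))
          ((measurable_one.indicator hs).comp (measurable_patch Λ ω))]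
      rfl
    simp only [h1]
    exact (P.measurable_marg Λ (P.measurable_weight Λ)).inv.mul
      (P.measurable_marg Λ ((measurable_one.indicator hs).mul (P.measurable_weight Λ)))

lemma gibbsKernel_apply (Λ : Finset (Site d)) (ω : Site d → S) :
    P.gibbsKernel Λ ω = (P.gibbs Λ ω).map (patch Λ ω) := rfl

instance isMarkovKernel_gibbsKernel (Λ : Finset (Site d)) : IsMarkovKernel (P.gibbsKernel Λ) :=
  ⟨fun ω => Measure.isProbabilityMeasure_map (measurable_patch Λ ω).aemeasurable⟩

lemma lintegral_gibbsKernel (Λ : Finset (Site d)) (ω : Site d → S) {F : (Site d → S) → ℝ≥0∞}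
    (hF : Measurable F) :
    ∫⁻ ω', F ω' ∂P.gibbsKernel Λ ω = ∫⁻ σ, F (patch Λ ω σ) ∂P.gibbs Λ ω :=
  lintegral_map hF (measurable_patch Λ ω)

lemma lintegral_gibbsKernel_eq_marg (Λ : Finset (Site d)) (ω : Site d → S)
    {F : (Site d → S) → ℝ≥0∞} (hF : Measurable F) :
    ∫⁻ ω', F ω' ∂P.gibbsKernel Λ ω
      = (P.marg Λ (P.weight Λ) ω)⁻¹ * P.marg Λ (fun ω => F ω * P.weight Λ ω) ω := by
  rw [P.lintegral_gibbsKernel Λ ω hF, P.lintegral_gibbs Λ ω (f := fun σ => F (patch Λ ω σ))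
    (hF.comp (measurable_patch Λ ω))]
  rfl

/-- The Dobrushin–Lanford–Ruelle equations. -/
lemma gibbsKernel_comp_of_subset {A V : Finset (Site d)} (h : A ⊆ V) :
    P.gibbsKernel A ∘ₖ P.gibbsKernel V = P.gibbsKernel (S := S) V := by
  refine Kernel.ext_fun fun ω F hF => ?_
  have hG : Measurable fun ω' => ∫⁻ ω'', F ω'' ∂P.gibbsKernel A ω' := hF.lintegral_kernel
  rw [Kernel.lintegral_comp _ _ _ hF, P.lintegral_gibbsKernel_eq_marg V ω hG,
    P.lintegral_gibbsKernel_eq_marg V ω hF]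
  congr 1
  have hwA := P.measurable_weight A
  have hwV := P.measurable_weight V
  refine congrFun (lmarginal_eq_of_subset (s := A) h (hG.mul hwV) (hF.mul hwV) ?_) ω
  -- the weight in `V` is the weight in `A` times a factor that ignores the spins in `A`
  set c : (Site d → S) → ℝ≥0∞ := fun ω =>
    ENNReal.ofReal (Real.exp (-(P.hamiltonian V ω - P.hamiltonian A ω))) with hc
  have hcA : IndepOf A c := fun ω ω' hω => by
    have := P.indepOf_hamiltonian_sub h ω ω' hω
    simp only [hc]
    simp only at this
    rw [this]
  have hwc : ∀ ω, P.weight V ω = c ω * P.weight A ω := fun ω => by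
    rw [hc, weight, weight, ← ENNReal.ofReal_mul (Real.exp_pos _).le, ← Real.exp_add]
    congr 2
    ring
  funext ω'
  have hb := P.marg_bounds (Λ := A) (Δ := A) ω'
  have e1 : P.marg A (fun ω => (∫⁻ ω'', F ω'' ∂P.gibbsKernel A ω) * P.weight V ω) ω'
      = (∫⁻ ω'', F ω'' ∂P.gibbsKernel A ω') * c ω' * P.marg A (P.weight A) ω' := by
    rw [← P.marg_mul_of_indepOf (c := fun ω => (∫⁻ ω'', F ω'' ∂P.gibbsKernel A ω) * c ω) ?_ hwA]
    · simp only [hwc, mul_assoc]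
    · intro ω₁ ω₂ h12
      simp only
      rw [hcA _ _ h12, P.lintegral_gibbsKernel_eq_marg A _ hF,
        P.lintegral_gibbsKernel_eq_marg A _ hF, P.indepOf_marg A _ _ _ h12,
        P.indepOf_marg A (fun ω => F ω * P.weight A ω) _ _ h12]
  have e2 : P.marg A (fun ω => F ω * P.weight V ω) ω'
      = c ω' * P.marg A (fun ω => F ω * P.weight A ω) ω' := by
    rw [← P.marg_mul_of_indepOf (F := fun ω => F ω * P.weight A ω) hcA (hF.mul hwA)]
    simp only [hwc, mul_left_comm]
  refine e1.trans (Eq.trans ?_ e2.symm)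
  rw [P.lintegral_gibbsKernel_eq_marg A ω' hF]
  calc _ = c ω' * P.marg A (fun ω => F ω * P.weight A ω) ω'
        * ((P.marg A (P.weight A) ω')⁻¹ * P.marg A (P.weight A) ω') := by ring
    _ = _ := by rw [ENNReal.inv_mul_cancel hb.1 hb.2, mul_one]

/-- Gibbs measures depend on the boundary condition through its values next to the region. -/
lemma gibbs_congr {Λ : Finset (Site d)} {ω ω' : Site d → S}
    (h : ∀ x ∈ extBoundary Λ, ω x = ω' x) : P.gibbs Λ ω = P.gibbs Λ ω' := by
  have hH : ∀ σ : Λ → S, P.hamiltonian Λ (patch Λ ω σ) = P.hamiltonian Λ (patch Λ ω' σ) := by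
    intro σ
    refine P.hamiltonian_congr (fun x hx => ?_) fun x hx => ?_
    · rw [patch_of_mem _ _ hx, patch_of_mem _ _ hx]
    · have hx' := (mem_extBoundary.1 hx).1
      rw [patch_of_notMem _ _ hx', patch_of_notMem _ _ hx', h x hx]
  unfold gibbs partitionFunction
  simp only [hH]

lemma gibbs_congr' {Λ : Finset (Site d)} {ω ω' : Site d → S}
    (h : ∀ x ∉ Λ, ω x = ω' x) : P.gibbs Λ ω = P.gibbs Λ ω' :=
  P.gibbs_congr fun x hx => h x (mem_extBoundary.1 hx).1

lemma indepOf_gibbsKernel (Λ : Finset (Site d)) : IndepOf Λ (P.gibbsKernel (S := S) Λ) := by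
  intro ω ω' h
  rw [gibbsKernel_apply, gibbsKernel_apply, P.gibbs_congr' h]
  congr 1
  exact funext fun σ => patch_congr h σ

/-- Two sets of sites that are disjoint and not joined by an edge. -/
def Separated (X Y : Finset (Site d)) : Prop :=
  ∀ x ∈ X, ∀ y ∈ Y, x ≠ y ∧ latticeDist x y ≠ 1

lemma Separated.symm {X Y : Finset (Site d)} (h : Separated X Y) : Separated Y X :=
  fun y hy x hx => ⟨(h x hx y hy).1.symm, latticeDist_comm x y ▸ (h x hx y hy).2⟩

lemma Separated.mono {X Y X' Y' : Finset (Site d)} (h : Separated X Y) (hX : X' ⊆ X)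
    (hY : Y' ⊆ Y) : Separated X' Y' :=
  fun x hx y hy => h x (hX hx) y (hY hy)

/-- Resampling `Y` commutes with changing the spins in a separated set `X`. -/
lemma Separated.indepOf_lintegral {X Y : Finset (Site d)} (h : Separated X Y)
    {G : (Site d → S) → ℝ≥0∞} (hG : IndepOf X G) (hGm : Measurable G) :
    IndepOf X fun ω => ∫⁻ ω', G ω' ∂P.gibbsKernel Y ω := by
  intro ω ω' hω
  have hg : P.gibbs Y ω = P.gibbs Y ω' := by
    refine P.gibbs_congr fun x hx => hω x fun hxX => ?_
    obtain ⟨-, y, hy, hyx⟩ := mem_extBoundary.1 hx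
    exact (h x hxX y hy).2 (latticeDist_comm x y ▸ hyx)
  simp only
  rw [P.lintegral_gibbsKernel _ _ hGm, P.lintegral_gibbsKernel _ _ hGm, hg]
  refine lintegral_congr fun σ => hG _ _ fun x hx => ?_
  by_cases hxY : x ∈ Y
  · rw [patch_of_mem _ _ hxY, patch_of_mem _ _ hxY]
  · rw [patch_of_notMem _ _ hxY, patch_of_notMem _ _ hxY, hω x hx]

/-- The Gibbs measure in a union of separated sets is a product measure. -/
lemma Separated.gibbsKernel_union {X Y : Finset (Site d)} (h : Separated X Y) :
    P.gibbsKernel (S := S) (X ∪ Y) = P.gibbsKernel X ∘ₖ P.gibbsKernel Y := by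
  refine Kernel.ext_fun fun ω F hF => ?_
  have hG : Measurable fun ω' => ∫⁻ ω'', F ω'' ∂P.gibbsKernel X ω' := hF.lintegral_kernel
  have hG' : Measurable fun ω₁ => ∫⁻ ω', ∫⁻ ω'', F ω'' ∂P.gibbsKernel X ω' ∂P.gibbsKernel Y ω₁ :=
    hG.lintegral_kernel
  have hind : IndepOf (X ∪ Y)
      fun ω₁ => ∫⁻ ω', ∫⁻ ω'', F ω'' ∂P.gibbsKernel X ω' ∂P.gibbsKernel Y ω₁ := by
    refine IndepOf.union (h.indepOf_lintegral P (fun ω₁ ω₂ h12 => ?_) hG) fun ω₁ ω₂ h12 => ?_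
    · rw [P.indepOf_gibbsKernel X ω₁ ω₂ h12]
    · rw [P.indepOf_gibbsKernel Y ω₁ ω₂ h12]
  rw [Kernel.lintegral_comp _ _ _ hF,
    ← P.gibbsKernel_comp_of_subset (Finset.subset_union_left (s₁ := X) (s₂ := Y)),
    Kernel.lintegral_comp _ _ _ hF,
    ← P.gibbsKernel_comp_of_subset (Finset.subset_union_right (s₁ := X) (s₂ := Y)),
    Kernel.lintegral_comp _ _ _ hG, P.lintegral_gibbsKernel _ _ hG']
  simp only [hind.apply_patch, lintegral_const, measure_univ, mul_one]

lemma Separated.gibbsKernel_comm {X Y : Finset (Site d)} (h : Separated X Y) :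
    P.gibbsKernel (S := S) X ∘ₖ P.gibbsKernel Y = P.gibbsKernel Y ∘ₖ P.gibbsKernel X := by
  rw [← h.gibbsKernel_union, ← h.symm.gibbsKernel_union, Finset.union_comm]

lemma avg_gibbsKernel (Λ : Finset (Site d)) {Φ : (Site d → S) → ℝ} (hΦ : Measurable Φ)
    (ω : Site d → S) :
    avg (P.gibbsKernel Λ) Φ ω = ∫ σ, Φ (patch Λ ω σ) ∂P.gibbs Λ ω :=
  integral_map (measurable_patch Λ ω).aemeasurable hΦ.aestronglyMeasurable

lemma indepOf_avg (Λ : Finset (Site d)) (Φ : (Site d → S) → ℝ) :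
    IndepOf Λ (avg (P.gibbsKernel Λ) Φ) := by
  intro ω ω' h
  rw [avg, avg, P.indepOf_gibbsKernel Λ ω ω' h]

lemma indepOf_kent (Λ : Finset (Site d)) (F : (Site d → S) → ℝ) :
    IndepOf Λ (kent (P.gibbsKernel Λ) F) := by
  intro ω ω' h
  rw [kent, kent, P.indepOf_avg Λ F ω ω' h, P.indepOf_avg Λ _ ω ω' h]

lemma avg_gibbsKernel_mul {Λ : Finset (Site d)} {Φ Ψ : (Site d → S) → ℝ} (hΦ : Measurable Φ)
    (hΨ : Measurable Ψ) (h : IndepOf Λ Ψ) (ω : Site d → S) :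
    avg (P.gibbsKernel Λ) (fun ω' => Φ ω' * Ψ ω') ω = avg (P.gibbsKernel Λ) Φ ω * Ψ ω := by
  rw [P.avg_gibbsKernel Λ (Φ := fun ω' => Φ ω' * Ψ ω') (hΦ.mul hΨ), P.avg_gibbsKernel Λ hΦ]
  simp only [h.apply_patch]
  exact integral_mul_const _ _

lemma avg_gibbsKernel_of_indepOf {Λ : Finset (Site d)} {Ψ : (Site d → S) → ℝ}
    (hΨ : Measurable Ψ) (h : IndepOf Λ Ψ) (ω : Site d → S) :
    avg (P.gibbsKernel Λ) Ψ ω = Ψ ω := by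
  rw [P.avg_gibbsKernel Λ hΨ]
  simp [h.apply_patch]

lemma isProper_gibbsKernel (Λ : Finset (Site d)) : IsProper (P.gibbsKernel (S := S) Λ) := by
  intro Φ G hΦ hG ω
  refine P.avg_gibbsKernel_mul hΦ.1 hG.avg.log.1 (fun ω ω' h => ?_) ω
  simp only
  rw [P.indepOf_avg Λ G ω ω' h]

/-- The entropy of a function that does not see the block vanishes. -/
lemma kent_gibbsKernel_of_indepOf {Λ : Finset (Site d)} {F : (Site d → S) → ℝ}
    (hF : PosBdd F) (h : IndepOf Λ F) (ω : Site d → S) : kent (P.gibbsKernel Λ) F ω = 0 := by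
  rw [kent, P.avg_gibbsKernel_of_indepOf hF.1 h,
    P.avg_gibbsKernel_of_indepOf hF.mul_log.1 (fun ω ω' hω => by rw [h ω ω' hω]), sub_self]

/-- A comparison that holds for all configurations with the given boundary condition can be
averaged. -/
lemma avg_gibbsKernel_mono {Λ : Finset (Site d)} {Φ Ψ : (Site d → S) → ℝ} (hΦ : BddMeas Φ)
    (hΨ : BddMeas Ψ) (ω : Site d → S)
    (h : ∀ ω', (∀ x ∉ Λ, ω' x = ω x) → Φ ω' ≤ Ψ ω') :
    avg (P.gibbsKernel Λ) Φ ω ≤ avg (P.gibbsKernel Λ) Ψ ω := by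
  rw [P.avg_gibbsKernel Λ hΦ.1, P.avg_gibbsKernel Λ hΨ.1]
  have hb : ∀ {Φ : (Site d → S) → ℝ}, BddMeas Φ → BddMeas fun σ => Φ (patch Λ ω σ) :=
    fun {Φ} hΦ => ⟨hΦ.1.comp (measurable_patch Λ ω), hΦ.2.imp fun M hM σ => hM _⟩
  exact integral_mono ((hb hΦ).integrable _) ((hb hΨ).integrable _) fun σ =>
    h _ fun x hx => patch_of_notMem _ _ hx

end SpinSystem

/-! ### Comparison of boundary conditions under strong spatial mixing -/

namespace SpinSystem

variable {d : ℕ} {S : Type*} [MeasurableSpace S] (P : SpinSystem S)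

lemma ofReal_marginalDensity {B Δ : Finset (Site d)} (τ : Site d → S) (σ : Δ → S) :
    ENNReal.ofReal (P.marginalDensity B Δ τ σ)
      = (P.marg B (P.weight B) τ)⁻¹ * P.marg (B \ Δ) (P.weight B) (patch Δ τ σ) := by
  have hp : ∀ η : (B \ Δ : Finset (Site d)) → S,
      patch Δ (patch (B \ Δ) τ η) σ = patch (B \ Δ) (patch Δ τ σ) η := by
    intro η
    funext x
    by_cases hx : x ∈ Δ
    · have hx' : x ∉ B \ Δ := fun h => (Finset.mem_sdiff.1 h).2 hx
      rw [patch_of_mem _ _ hx, patch_of_notMem _ _ hx', patch_of_mem _ _ hx]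
    · by_cases hx' : x ∈ B \ Δ
      · rw [patch_of_notMem _ _ hx, patch_of_mem _ _ hx', patch_of_mem _ _ hx']
      · rw [patch_of_notMem _ _ hx, patch_of_notMem _ _ hx', patch_of_notMem _ _ hx',
          patch_of_notMem _ _ hx]
  unfold marginalDensity
  simp only [hp]
  rw [P.integral_exp_eq_toReal_marg, P.ofReal_gibbs_density _ _ _ (P.marg_bounds _).2]

lemma marginalDensity_pos {B Δ : Finset (Site d)} (τ : Site d → S) (σ : Δ → S) :
    0 < P.marginalDensity B Δ τ σ := by
  rw [← ENNReal.ofReal_pos, ofReal_marginalDensity, pos_iff_ne_zero]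
  exact mul_ne_zero (ENNReal.inv_ne_zero.2 (P.marg_bounds _).2) (P.marg_bounds _).1

lemma lintegral_gibbs_patch {B Δ : Finset (Site d)} (hΔ : Δ ⊆ B) {Ψ : (Site d → S) → ℝ≥0∞}
    (hΨ : Measurable Ψ) (hind : IndepOf (B \ Δ) Ψ) (τ ω : Site d → S) :
    ∫⁻ ξ, Ψ (patch B ω ξ) ∂P.gibbs B τ = ∫⁻ σ, Ψ (patch Δ ω σ) *
      ENNReal.ofReal (P.marginalDensity B Δ τ σ) ∂P.refMeasure Δ := by
  -- read the spins of `Ψ` in `Δ` from the argument and all others from `ω`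
  set Ψ' : (Site d → S) → ℝ≥0∞ := fun ζ => Ψ fun x => if x ∈ Δ then ζ x else ω x with hΨ'
  have hm : Measurable Ψ' := by
    refine hΨ.comp (measurable_pi_iff.2 fun x => ?_)
    by_cases hx : x ∈ Δ
    · simpa [hx] using measurable_pi_apply x
    · simp [hx]
  have hind' : IndepOf (B \ Δ) Ψ' := by
    intro ζ ζ' h
    simp only [hΨ']
    congr 1
    funext x
    by_cases hx : x ∈ Δ
    · simp only [hx, if_true]
      exact h x fun h' => (Finset.mem_sdiff.1 h').2 hx
    · simp [hx]
  have e1 : ∀ ξ : B → S, Ψ (patch B ω ξ) = Ψ' (patch B τ ξ) := by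
    intro ξ
    refine hind _ _ fun x hx => ?_
    by_cases hxΔ : x ∈ Δ
    · simp only [hxΔ, if_true]
      rw [patch_of_mem _ _ (hΔ hxΔ), patch_of_mem _ _ (hΔ hxΔ)]
    · simp only [hxΔ, if_false]
      rw [patch_of_notMem _ _ fun h => hx (Finset.mem_sdiff.2 ⟨h, hxΔ⟩)]
  have e2 : ∀ σ : Δ → S, Ψ' (patch Δ τ σ) = Ψ (patch Δ ω σ) := by
    intro σ
    simp only [hΨ']
    congr 1
    funext x
    by_cases hx : x ∈ Δ
    · simp [hx, patch_of_mem]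
    · simp [hx, patch_of_notMem]
  have e3 : P.marg B (fun ζ => Ψ' ζ * P.weight B ζ) τ
      = P.marg Δ (P.marg (B \ Δ) fun ζ => Ψ' ζ * P.weight B ζ) τ := by
    have := congrFun (lmarginal_union (fun _ => P.ν) (fun ζ => Ψ' ζ * P.weight B ζ)
      (hm.mul (P.measurable_weight B)) (Finset.disjoint_sdiff (s := Δ) (t := B))) τ
    rwa [Finset.union_sdiff_of_subset hΔ] at this
  rw [P.lintegral_gibbs B τ (f := fun ξ => Ψ (patch B ω ξ)) (hΨ.comp (measurable_patch B ω))]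
  simp only [e1]
  rw [← P.marg_apply B (fun ζ => Ψ' ζ * P.weight B ζ), e3,
    P.marg_apply Δ,
    ← lintegral_const_mul' _ _ (ENNReal.inv_ne_top.2 (P.marg_bounds _).1)]
  refine lintegral_congr fun σ => ?_
  rw [P.marg_mul_of_indepOf hind' (P.measurable_weight B), e2, ofReal_marginalDensity]
  ring

lemma le_distToSet {x : Site d} {Δ : Finset (Site d)} (hne : Δ.Nonempty) {r : ℕ}
    (h : ∀ y ∈ Δ, r ≤ latticeDist x y) : r ≤ distToSet x Δ := by
  have hne' : ((latticeDist x) '' (Δ : Set (Site d))).Nonempty := by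
    simpa using hne
  obtain ⟨y, hy, hxy⟩ := Nat.sInf_mem hne'
  rw [distToSet, ← hxy]
  exact h y hy

/-- Changing the boundary condition at one site changes the law of the spins in `Δ` by a factor of
at most `1 + K exp (- a r)`. -/
lemma MixingCondition.lintegral_le_of_single {P : SpinSystem S} {K a : ℝ} (hK : 0 ≤ K)
    (ha : 0 ≤ a) {B Δ : Finset (Site d)} (h : P.MixingCondition B K a) (hΔ : Δ ⊆ B) {r : ℕ}
    {x : Site d} (hx : x ∈ extBoundary B) (hr : ∀ y ∈ Δ, r ≤ latticeDist x y)
    {Ψ : (Site d → S) → ℝ≥0∞} (hΨ : Measurable Ψ) (hind : IndepOf (B \ Δ) Ψ)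
    {τ τ' : Site d → S} (hτ : ∀ y, y ≠ x → τ y = τ' y) (ω : Site d → S) :
    ∫⁻ ξ, Ψ (patch B ω ξ) ∂P.gibbs B τ' ≤
      ENNReal.ofReal (1 + K * Real.exp (-a * r)) * ∫⁻ ξ, Ψ (patch B ω ξ) ∂P.gibbs B τ := by
  have hexp := Real.exp_pos (-a * r)
  rcases Δ.eq_empty_or_nonempty with rfl | hne
  · rw [Finset.sdiff_empty] at hind
    simp only [hind.apply_patch, lintegral_const, measure_univ, mul_one]
    refine le_mul_of_one_le_left zero_le ?_
    rw [ENNReal.one_le_ofReal]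
    nlinarith
  have hdist : Real.exp (-a * distToSet x Δ) ≤ Real.exp (-a * r) := by
    have : (r : ℝ) ≤ distToSet x Δ := by exact_mod_cast le_distToSet hne hr
    exact Real.exp_le_exp.2 (by nlinarith)
  have hae : ∀ᵐ σ ∂P.refMeasure Δ, P.marginalDensity B Δ τ' σ
      ≤ (1 + K * Real.exp (-a * r)) * P.marginalDensity B Δ τ σ := by
    have h1 := h Δ hΔ x hx τ τ' fun y _ hy => hτ y hy
    rw [eLpNorm_exponent_top] at h1
    filter_upwards [ae_le_eLpNormEssSup (μ := P.refMeasure Δ)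
      (f := fun σ => P.marginalDensity B Δ τ' σ / P.marginalDensity B Δ τ σ - 1)] with σ hσ
    have h2 := hσ.trans h1
    rw [← ofReal_norm, ENNReal.ofReal_le_ofReal_iff (by positivity), Real.norm_eq_abs]
      at h2
    have h3 := (abs_le.1 h2).2
    have hpos := P.marginalDensity_pos (B := B) τ σ
    rw [sub_le_iff_le_add, div_le_iff₀ hpos] at h3
    refine h3.trans (mul_le_mul_of_nonneg_right ?_ hpos.le)
    nlinarith
  rw [P.lintegral_gibbs_patch hΔ hΨ hind, P.lintegral_gibbs_patch hΔ hΨ hind,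
    ← lintegral_const_mul' _ _ ENNReal.ofReal_ne_top]
  refine lintegral_mono_ae ?_
  filter_upwards [hae] with σ hσ
  rw [mul_left_comm, ← ENNReal.ofReal_mul (by positivity)]
  exact mul_le_mul_right (ENNReal.ofReal_le_ofReal hσ) _

/-- Changing the boundary condition on a set `T` at distance `r` from `Δ` changes the law of the
spins in `Δ` by a factor of at most `(1 + K exp (- a r)) ^ |T|`. The spins outside `B` that are seen
by `Ψ` are those of `ω` on both sides. -/
lemma MixingCondition.lintegral_le {P : SpinSystem S} {K a : ℝ} (hK : 0 ≤ K) (ha : 0 ≤ a)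
    {B Δ : Finset (Site d)} (h : P.MixingCondition B K a) (hΔ : Δ ⊆ B) {r : ℕ}
    {Ψ : (Site d → S) → ℝ≥0∞} (hΨ : Measurable Ψ) (hind : IndepOf (B \ Δ) Ψ) (ω : Site d → S)
    (T : Finset (Site d)) (hr : ∀ x ∈ T, ∀ y ∈ Δ, r ≤ latticeDist x y) (τ τ' : Site d → S)
    (hτ : ∀ y ∈ extBoundary B, y ∉ T → τ y = τ' y) :
    ∫⁻ ξ, Ψ (patch B ω ξ) ∂P.gibbs B τ' ≤
      ENNReal.ofReal (1 + K * Real.exp (-a * r)) ^ T.card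
        * ∫⁻ ξ, Ψ (patch B ω ξ) ∂P.gibbs B τ := by
  induction T using Finset.induction generalizing τ with
  | empty =>
    rw [P.gibbs_congr fun y hy => hτ y hy (Finset.notMem_empty y)]
    simp
  | insert x T hxT ih =>
    have h1 := ih (fun y hy => hr y (Finset.mem_insert_of_mem hy)) (Function.update τ x (τ' x))
      fun y hy hyT => by
        by_cases hyx : y = x
        · simp [hyx]
        · rw [Function.update_of_ne hyx]
          exact hτ y hy (by simp [hyx, hyT])
    have h2 : ∫⁻ ξ, Ψ (patch B ω ξ) ∂P.gibbs B (Function.update τ x (τ' x)) ≤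
        ENNReal.ofReal (1 + K * Real.exp (-a * r)) * ∫⁻ ξ, Ψ (patch B ω ξ) ∂P.gibbs B τ := by
      by_cases hx : x ∈ extBoundary B
      · exact h.lintegral_le_of_single hK ha hΔ hx (hr x (Finset.mem_insert_self x T)) hΨ hind
          (fun y hy => (Function.update_of_ne hy _ _).symm) ω
      · rw [P.gibbs_congr (ω := Function.update τ x (τ' x)) (ω' := τ) fun y hy =>
          Function.update_of_ne (ne_of_mem_of_not_mem hy hx) _ _]
        refine le_mul_of_one_le_left zero_le ?_
        rw [ENNReal.one_le_ofReal]
        have := Real.exp_pos (-a * r)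
        nlinarith
    rw [Finset.card_insert_of_notMem hxT, pow_succ, mul_assoc]
    exact h1.trans (mul_le_mul_right h2 _)

/-- The comparison of boundary conditions for bounded nonnegative functions. -/
lemma MixingCondition.integral_le {P : SpinSystem S} {K a : ℝ} (hK : 0 ≤ K) (ha : 0 ≤ a)
    {B Δ : Finset (Site d)} (h : P.MixingCondition B K a) (hΔ : Δ ⊆ B) {r : ℕ}
    {Φ : (Site d → S) → ℝ} (hΦ : BddMeas Φ) (h0 : ∀ ω, 0 ≤ Φ ω) (hind : IndepOf (B \ Δ) Φ)
    (ω : Site d → S) (T : Finset (Site d)) (hr : ∀ x ∈ T, ∀ y ∈ Δ, r ≤ latticeDist x y)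
    (τ τ' : Site d → S) (hτ : ∀ y ∈ extBoundary B, y ∉ T → τ y = τ' y) :
    ∫ ξ, Φ (patch B ω ξ) ∂P.gibbs B τ' ≤
      (1 + K * Real.exp (-a * r)) ^ T.card * ∫ ξ, Φ (patch B ω ξ) ∂P.gibbs B τ := by
  have hm : Measurable fun ξ => Φ (patch B ω ξ) := hΦ.1.comp (measurable_patch B ω)
  have hint : ∀ τ, Integrable (fun ξ => Φ (patch B ω ξ)) (P.gibbs B τ) := fun τ =>
    BddMeas.integrable ⟨hm, hΦ.2.imp fun M hM σ => hM _⟩ _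
  have key := h.lintegral_le hK ha hΔ (Ψ := fun ω => ENNReal.ofReal (Φ ω))
    hΦ.1.ennreal_ofReal (fun ω ω' hω => congrArg ENNReal.ofReal (hind ω ω' hω)) ω T hr τ τ' hτ
  rw [← ofReal_integral_eq_lintegral_ofReal (hint τ') (Filter.Eventually.of_forall fun _ => h0 _),
    ← ofReal_integral_eq_lintegral_ofReal (hint τ) (Filter.Eventually.of_forall fun _ => h0 _),
    ← ENNReal.ofReal_pow (by positivity), ← ENNReal.ofReal_mul (by positivity)] at key
  rwa [ENNReal.ofReal_le_ofReal_iff (mul_nonneg (by positivity) (integral_nonneg fun _ => h0 _))]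
    at key

end SpinSystem

/-! ### Factorization of the entropy over two overlapping blocks -/

namespace SpinSystem

variable {d : ℕ} {S : Type*}

/-- The configuration with spins `ω₀` in `N`, `ξ` in `B \ N` and `ω` outside `B ∪ N`. -/
def pinPatch (B N : Finset (Site d)) (ω₀ ω : Site d → S) (ξ : B → S) : Site d → S :=
  fun x => if x ∈ N then ω₀ x else patch B ω ξ x

lemma pinPatch_of_notMem {B N : Finset (Site d)} (hN : N ⊆ B) (ω₀ ω : Site d → S) (ξ : B → S)
    {x : Site d} (hx : x ∉ B) : pinPatch B N ω₀ ω ξ x = ω x := by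
  rw [pinPatch, if_neg fun h => hx (hN h), patch_of_notMem _ _ hx]

variable [MeasurableSpace S] (P : SpinSystem S)

lemma measurable_pinPatch_prod (B N : Finset (Site d)) (ω₀ : Site d → S) :
    Measurable fun p : (Site d → S) × (B → S) => pinPatch B N ω₀ p.1 p.2 := by
  refine measurable_pi_iff.2 fun x => ?_
  by_cases hx : x ∈ N
  · simp [pinPatch, hx]
  · simp only [pinPatch, hx, if_false]
    exact (measurable_pi_apply x).comp (measurable_patch_prod B)

lemma measurable_pinPatch (B N : Finset (Site d)) (ω₀ ω : Site d → S) :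
    Measurable (pinPatch B N ω₀ ω) :=
  (measurable_pinPatch_prod B N ω₀).comp measurable_prodMk_left

/-- The kernel that resamples the spins in `B` from the Gibbs measure with boundary condition `ω₀`,
whatever the current configuration is, and resets the spins in `N` to `ω₀`. Unlike Gibbs kernels,
two such kernels commute as soon as their blocks overlap only in `N`: together they sample from a
product measure. -/
def frozenKernel (B N : Finset (Site d)) (ω₀ : Site d → S) :
    Kernel (Site d → S) (Site d → S) where
  toFun ω := (P.gibbs B ω₀).map (pinPatch B N ω₀ ω)
  measurable' := by
    refine Measure.measurable_of_measurable_coe _ fun s hs => ?_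
    simp only [Measure.map_apply (measurable_pinPatch B N ω₀ _) hs]
    exact measurable_measure_prodMk_left (measurable_pinPatch_prod B N ω₀ hs)

instance isMarkovKernel_frozenKernel (B N : Finset (Site d)) (ω₀ : Site d → S) :
    IsMarkovKernel (P.frozenKernel B N ω₀) :=
  ⟨fun ω => Measure.isProbabilityMeasure_map (measurable_pinPatch B N ω₀ ω).aemeasurable⟩

lemma lintegral_frozenKernel (B N : Finset (Site d)) (ω₀ ω : Site d → S)
    {F : (Site d → S) → ℝ≥0∞} (hF : Measurable F) :
    ∫⁻ ω', F ω' ∂P.frozenKernel B N ω₀ ω = ∫⁻ ξ, F (pinPatch B N ω₀ ω ξ) ∂P.gibbs B ω₀ :=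
  lintegral_map hF (measurable_pinPatch B N ω₀ ω)

lemma avg_frozenKernel (B N : Finset (Site d)) (ω₀ ω : Site d → S)
    {Φ : (Site d → S) → ℝ} (hΦ : Measurable Φ) :
    avg (P.frozenKernel B N ω₀) Φ ω = ∫ ξ, Φ (pinPatch B N ω₀ ω ξ) ∂P.gibbs B ω₀ :=
  integral_map (measurable_pinPatch B N ω₀ ω).aemeasurable hΦ.aestronglyMeasurable

lemma frozenKernel_comm {A B N : Finset (Site d)} (hN : A ∩ B ⊆ N) (ω₀ : Site d → S) :
    P.frozenKernel A N ω₀ ∘ₖ P.frozenKernel B N ω₀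
      = P.frozenKernel B N ω₀ ∘ₖ P.frozenKernel A N ω₀ := by
  refine Kernel.ext_fun fun ω F hF => ?_
  rw [Kernel.lintegral_comp _ _ _ hF, Kernel.lintegral_comp _ _ _ hF,
    P.lintegral_frozenKernel _ _ _ _ hF.lintegral_kernel,
    P.lintegral_frozenKernel _ _ _ _ hF.lintegral_kernel]
  simp only [P.lintegral_frozenKernel _ _ _ _ hF]
  have hcomm : ∀ (ξ : B → S) (η : A → S), pinPatch A N ω₀ (pinPatch B N ω₀ ω ξ) η
      = pinPatch B N ω₀ (pinPatch A N ω₀ ω η) ξ := by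
    intro ξ η
    funext x
    by_cases hx : x ∈ N
    · simp [pinPatch, hx]
    · have hAB : ¬(x ∈ A ∧ x ∈ B) := fun h => hx (hN (Finset.mem_inter.2 h))
      by_cases hA : x ∈ A <;> by_cases hB : x ∈ B <;> simp [pinPatch, patch, hx, hA, hB]; tauto
  have hm : Measurable fun p : (B → S) × (A → S) =>
      F (pinPatch A N ω₀ (pinPatch B N ω₀ ω p.1) p.2) :=
    hF.comp ((measurable_pinPatch_prod A N ω₀).comp
      (((measurable_pinPatch B N ω₀ ω).comp measurable_fst).prodMk measurable_snd))
  rw [lintegral_lintegral_swap (f := fun ξ η => F (pinPatch A N ω₀ (pinPatch B N ω₀ ω ξ) η))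
    hm.aemeasurable]
  simp only [hcomm]

lemma indepOf_avg_frozenKernel (B N : Finset (Site d)) (ω₀ : Site d → S)
    (Φ : (Site d → S) → ℝ) : IndepOf B (avg (P.frozenKernel B N ω₀) Φ) := by
  intro ω ω' h
  have : P.frozenKernel B N ω₀ ω = P.frozenKernel B N ω₀ ω' := by
    change (P.gibbs B ω₀).map (pinPatch B N ω₀ ω) = (P.gibbs B ω₀).map (pinPatch B N ω₀ ω')
    congr 1
    funext ξ x
    simp only [pinPatch]
    rw [patch_congr h]
  rw [avg, avg, this]

lemma avg_frozenKernel_mul {B N : Finset (Site d)} (hN : N ⊆ B) (ω₀ : Site d → S)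
    {Φ Ψ : (Site d → S) → ℝ} (hΦ : Measurable Φ) (hΨ : Measurable Ψ) (h : IndepOf B Ψ)
    (ω : Site d → S) :
    avg (P.frozenKernel B N ω₀) (fun ω' => Φ ω' * Ψ ω') ω
      = avg (P.frozenKernel B N ω₀) Φ ω * Ψ ω := by
  rw [P.avg_frozenKernel _ _ _ _ (Φ := fun ω' => Φ ω' * Ψ ω') (hΦ.mul hΨ),
    P.avg_frozenKernel _ _ _ _ hΦ]
  have : ∀ ξ, Ψ (pinPatch B N ω₀ ω ξ) = Ψ ω := fun ξ =>
    h _ _ fun x hx => pinPatch_of_notMem hN ω₀ ω ξ hx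
  simp only [this]
  exact integral_mul_const _ _

lemma avg_frozenKernel_of_indepOf {B N : Finset (Site d)} (hN : N ⊆ B) (ω₀ : Site d → S)
    {Ψ : (Site d → S) → ℝ} (hΨ : Measurable Ψ) (h : IndepOf B Ψ) (ω : Site d → S) :
    avg (P.frozenKernel B N ω₀) Ψ ω = Ψ ω := by
  have := P.avg_frozenKernel_mul hN ω₀ (Φ := fun _ => 1) measurable_const hΨ h ω
  simpa [avg_const] using this

lemma isProper_frozenKernel {B N : Finset (Site d)} (hN : N ⊆ B) (ω₀ : Site d → S) :
    IsProper (P.frozenKernel B N ω₀) := by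
  intro Φ G hΦ hG ω
  refine P.avg_frozenKernel_mul hN ω₀ hΦ.1 hG.avg.log.1 (fun ω ω' h => ?_) ω
  simp only
  rw [P.indepOf_avg_frozenKernel B N ω₀ G ω ω' h]

lemma avg_frozenKernel_mono {B N : Finset (Site d)} (hN : N ⊆ B) {ω₀ : Site d → S}
    {Φ Ψ : (Site d → S) → ℝ} (hΦ : BddMeas Φ) (hΨ : BddMeas Ψ) (ω : Site d → S)
    (h : ∀ ω', (∀ x ∉ B, ω' x = ω x) → Φ ω' ≤ Ψ ω') :
    avg (P.frozenKernel B N ω₀) Φ ω ≤ avg (P.frozenKernel B N ω₀) Ψ ω := by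
  rw [P.avg_frozenKernel _ _ _ _ hΦ.1, P.avg_frozenKernel _ _ _ _ hΨ.1]
  have hb : ∀ {Φ : (Site d → S) → ℝ}, BddMeas Φ → BddMeas fun ξ => Φ (pinPatch B N ω₀ ω ξ) :=
    fun {Φ} hΦ => ⟨hΦ.1.comp (measurable_pinPatch B N ω₀ ω), hΦ.2.imp fun M hM σ => hM _⟩
  exact integral_mono ((hb hΦ).integrable _) ((hb hΨ).integrable _) fun σ =>
    h _ fun x hx => pinPatch_of_notMem hN ω₀ ω σ hx

/-- Under mixing, the Gibbs kernel and the kernel with frozen boundary condition are comparable on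
functions that only see the spins of `B` in `Δ`, if the boundary conditions differ only on a set `T`
at distance `r` from `Δ`. -/
lemma MixingCondition.avg_frozenKernel_compare {P : SpinSystem S} {K a : ℝ} (hK : 0 ≤ K)
    (ha : 0 ≤ a) {B Δ : Finset (Site d)} (h : P.MixingCondition B K a) (hΔ : Δ ⊆ B) {r : ℕ}
    {T : Finset (Site d)} (hr : ∀ x ∈ T, ∀ y ∈ Δ, r ≤ latticeDist x y)
    {ω₀ ω : Site d → S} (hω : ∀ y ∈ extBoundary B, y ∉ T → ω y = ω₀ y)
    {Φ : (Site d → S) → ℝ} (hΦ : BddMeas Φ) (h0 : ∀ ω, 0 ≤ Φ ω) (hind : IndepOf (B \ Δ) Φ) :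
    avg (P.gibbsKernel B) Φ ω
        ≤ (1 + K * Real.exp (-a * r)) ^ T.card * avg (P.frozenKernel B (B \ Δ) ω₀) Φ ω ∧
      avg (P.frozenKernel B (B \ Δ) ω₀) Φ ω
        ≤ (1 + K * Real.exp (-a * r)) ^ T.card * avg (P.gibbsKernel B) Φ ω := by
  have e : avg (P.frozenKernel B (B \ Δ) ω₀) Φ ω = ∫ ξ, Φ (patch B ω ξ) ∂P.gibbs B ω₀ := by
    rw [P.avg_frozenKernel _ _ _ _ hΦ.1]
    refine integral_congr_ae (Filter.Eventually.of_forall fun ξ => hind _ _ fun x hx => ?_)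
    rw [pinPatch, if_neg hx]
  rw [e, P.avg_gibbsKernel _ hΦ.1]
  exact ⟨h.integral_le hK ha hΔ hΦ h0 hind ω T hr ω₀ ω fun y hy hyT => (hω y hy hyT).symm,
    h.integral_le hK ha hΔ hΦ h0 hind ω T hr ω ω₀ hω⟩

/-- Factorization of the entropy over two overlapping blocks. If `V = A ∪ B` and the sets `V \ A`
and `V \ B` are at distance `r`, then the Gibbs measure in `V` is, on these two sets, comparable to
the product of two Gibbs measures with frozen boundary conditions, for which the entropy is
subadditive. -/
theorem kent_le_of_overlap {K a : ℝ} (hK : 0 ≤ K) (ha : 0 ≤ a) {A B V : Finset (Site d)}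
    (hAB : A ∪ B = V) (hA : P.MixingCondition A K a) (hB : P.MixingCondition B K a) {r : ℕ}
    (hr : ∀ x ∈ V \ A, ∀ y ∈ V \ B, r ≤ latticeDist x y) {F : (Site d → S) → ℝ} (hF : PosBdd F)
    (ω₀ : Site d → S) :
    kent (P.gibbsKernel V) F ω₀ ≤ ((1 + K * Real.exp (-a * r)) ^ V.card) ^ 5 *
      (avg (P.gibbsKernel V) (kent (P.gibbsKernel A) F) ω₀
        + avg (P.gibbsKernel V) (kent (P.gibbsKernel B) F) ω₀) := by
  set q : ℝ := 1 + K * Real.exp (-a * r) with hq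
  have hq1 : 1 ≤ q := by
    have := Real.exp_pos (-a * r)
    rw [hq]
    nlinarith
  set C : ℝ := q ^ V.card with hC
  have hC1 : 1 ≤ C := one_le_pow₀ hq1
  have hC0 : 0 ≤ C := zero_le_one.trans hC1
  have hAV : A ⊆ V := hAB ▸ Finset.subset_union_left
  have hBV : B ⊆ V := hAB ▸ Finset.subset_union_right
  have hmem : ∀ x, x ∈ V ↔ x ∈ A ∨ x ∈ B := fun x => by rw [← hAB, Finset.mem_union]
  set N : Finset (Site d) := A ∩ B with hN
  have hNA : N ⊆ A := Finset.inter_subset_left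
  have hNB : N ⊆ B := Finset.inter_subset_right
  have hNB' : B \ (V \ A) = N := by
    ext x
    simp only [hN, Finset.mem_sdiff, Finset.mem_inter, hmem]
    tauto
  have hNA' : A \ (V \ B) = N := by
    ext x
    simp only [hN, Finset.mem_sdiff, Finset.mem_inter, hmem]
    tauto
  set RA := P.frozenKernel A N ω₀ with hRA
  set RB := P.frozenKernel B N ω₀ with hRB
  -- the two-sided comparison of each Gibbs kernel with its frozen version
  have cmpB : ∀ Φ : (Site d → S) → ℝ, BddMeas Φ → (∀ ω, 0 ≤ Φ ω) → IndepOf N Φ →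
      ∀ ω, (∀ x ∉ V, ω x = ω₀ x) →
        avg (P.gibbsKernel B) Φ ω ≤ C * avg RB Φ ω ∧
          avg RB Φ ω ≤ C * avg (P.gibbsKernel B) Φ ω := by
    intro Φ hΦ h0 hind ω hω
    have hsub : V \ A ⊆ B := fun x hx => by
      rw [Finset.mem_sdiff, hmem] at hx
      tauto
    have := hB.avg_frozenKernel_compare hK ha (Δ := V \ A) hsub (T := V \ B) (r := r)
      (fun x hx y hy => latticeDist_comm y x ▸ hr y hy x hx) (ω₀ := ω₀) (ω := ω)
      (fun y hy hyT => hω y fun hyV => hyT (Finset.mem_sdiff.2 ⟨hyV, (mem_extBoundary.1 hy).1⟩))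
      hΦ h0 (hNB'.symm ▸ hind)
    rw [hNB'] at this
    have hle : q ^ (V \ B).card ≤ C :=
      pow_le_pow_right₀ hq1 (Finset.card_le_card Finset.sdiff_subset)
    exact ⟨this.1.trans (mul_le_mul_of_nonneg_right hle (avg_nonneg h0 ω)),
      this.2.trans (mul_le_mul_of_nonneg_right hle (avg_nonneg h0 ω))⟩
  have cmpA : ∀ Φ : (Site d → S) → ℝ, BddMeas Φ → (∀ ω, 0 ≤ Φ ω) → IndepOf N Φ →
      ∀ ω, (∀ x ∉ V, ω x = ω₀ x) →
        avg (P.gibbsKernel A) Φ ω ≤ C * avg RA Φ ω ∧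
          avg RA Φ ω ≤ C * avg (P.gibbsKernel A) Φ ω := by
    intro Φ hΦ h0 hind ω hω
    have hsub : V \ B ⊆ A := fun x hx => by
      rw [Finset.mem_sdiff, hmem] at hx
      tauto
    have := hA.avg_frozenKernel_compare hK ha (Δ := V \ B) hsub (T := V \ A) (r := r)
      (fun x hx y hy => hr x hx y hy) (ω₀ := ω₀) (ω := ω)
      (fun y hy hyT => hω y fun hyV => hyT (Finset.mem_sdiff.2 ⟨hyV, (mem_extBoundary.1 hy).1⟩))
      hΦ h0 (hNA'.symm ▸ hind)
    rw [hNA'] at this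
    have hle : q ^ (V \ A).card ≤ C :=
      pow_le_pow_right₀ hq1 (Finset.card_le_card Finset.sdiff_subset)
    exact ⟨this.1.trans (mul_le_mul_of_nonneg_right hle (avg_nonneg h0 ω)),
      this.2.trans (mul_le_mul_of_nonneg_right hle (avg_nonneg h0 ω))⟩
  have hcomm : RA ∘ₖ RB = RB ∘ₖ RA := P.frozenKernel_comm hN.symm.subset ω₀
  have hcomm' : ∀ {Φ : (Site d → S) → ℝ}, BddMeas Φ → avg RB (avg RA Φ) = avg RA (avg RB Φ) := by
    intro Φ hΦ
    rw [avg_avg hΦ, avg_avg hΦ, hcomm]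
  have hVA : ∀ {Φ : (Site d → S) → ℝ}, BddMeas Φ →
      avg (P.gibbsKernel V) (avg (P.gibbsKernel A) Φ) = avg (P.gibbsKernel V) Φ := by
    intro Φ hΦ
    rw [avg_avg hΦ, P.gibbsKernel_comp_of_subset hAV]
  have hVB : ∀ {Φ : (Site d → S) → ℝ}, BddMeas Φ →
      avg (P.gibbsKernel V) (avg (P.gibbsKernel B) Φ) = avg (P.gibbsKernel V) Φ := by
    intro Φ hΦ
    rw [avg_avg hΦ, P.gibbsKernel_comp_of_subset hBV]
  have hprod : ∀ {Φ : (Site d → S) → ℝ}, BddMeas Φ →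
      avg (P.gibbsKernel V) (avg RA (avg RB Φ)) ω₀ = avg RA (avg RB Φ) ω₀ := by
    intro Φ hΦ
    refine P.avg_gibbsKernel_of_indepOf hΦ.avg.avg.1 ?_ ω₀
    rw [← hAB]
    refine IndepOf.union (P.indepOf_avg_frozenKernel A N ω₀ _) ?_
    rw [← hcomm' hΦ]
    exact P.indepOf_avg_frozenKernel B N ω₀ _
  have hindB : ∀ Φ, IndepOf N (avg RB Φ) := fun Φ =>
    (P.indepOf_avg_frozenKernel B N ω₀ Φ).mono hNB
  -- comparison of the Gibbs measure in `V` with the product measure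
  have upper : ∀ Φ : (Site d → S) → ℝ, BddMeas Φ → (∀ ω, 0 ≤ Φ ω) → IndepOf N Φ →
      avg (P.gibbsKernel V) Φ ω₀ ≤ C ^ 2 * avg RA (avg RB Φ) ω₀ := by
    intro Φ hΦ h0 hind
    have h1 : avg (P.gibbsKernel V) Φ ω₀ ≤ C * avg (P.gibbsKernel V) (avg RB Φ) ω₀ := by
      rw [← hVB hΦ, ← avg_const_mul]
      exact P.avg_gibbsKernel_mono hΦ.avg ((BddMeas.const C).mul hΦ.avg) ω₀ fun ω hω =>
        (cmpB Φ hΦ h0 hind ω hω).1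
    have h2 : avg (P.gibbsKernel V) (avg RB Φ) ω₀ ≤ C * avg RA (avg RB Φ) ω₀ := by
      rw [← hprod hΦ, ← hVA hΦ.avg, ← avg_const_mul]
      exact P.avg_gibbsKernel_mono hΦ.avg.avg ((BddMeas.const C).mul hΦ.avg.avg) ω₀ fun ω hω =>
        (cmpA _ hΦ.avg (avg_nonneg h0) (hindB Φ) ω hω).1
    calc _ ≤ C * (C * avg RA (avg RB Φ) ω₀) := h1.trans (mul_le_mul_of_nonneg_left h2 hC0)
      _ = _ := by ring
  have lower : ∀ Φ : (Site d → S) → ℝ, BddMeas Φ → (∀ ω, 0 ≤ Φ ω) → IndepOf N Φ →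
      avg RA (avg RB Φ) ω₀ ≤ C ^ 2 * avg (P.gibbsKernel V) Φ ω₀ := by
    intro Φ hΦ h0 hind
    have h1 : avg (P.gibbsKernel V) (avg RB Φ) ω₀ ≤ C * avg (P.gibbsKernel V) Φ ω₀ := by
      rw [← hVB hΦ, ← avg_const_mul]
      exact P.avg_gibbsKernel_mono hΦ.avg ((BddMeas.const C).mul hΦ.avg) ω₀ fun ω hω =>
        (cmpB Φ hΦ h0 hind ω hω).2
    have h2 : avg RA (avg RB Φ) ω₀ ≤ C * avg (P.gibbsKernel V) (avg RB Φ) ω₀ := by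
      rw [← hprod hΦ, ← hVA hΦ.avg, ← avg_const_mul]
      exact P.avg_gibbsKernel_mono hΦ.avg.avg ((BddMeas.const C).mul hΦ.avg.avg) ω₀ fun ω hω =>
        (cmpA _ hΦ.avg (avg_nonneg h0) (hindB Φ) ω hω).2
    calc _ ≤ C * (C * avg (P.gibbsKernel V) Φ ω₀) := h2.trans (mul_le_mul_of_nonneg_left h1 hC0)
      _ = _ := by ring
  -- the overlap contributes the same amount to all three entropies, so average it out
  set G : (Site d → S) → ℝ := avg (P.gibbsKernel N) F with hG
  have hGp : PosBdd G := hF.avg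
  have hGN : IndepOf N G := P.indepOf_avg N F
  have hdiv : ∀ t : ℝ, IndepOf N fun ω => entDiv (G ω) t := fun t ω ω' h => by
    simp only [hGN ω ω' h]
  have entB : ∀ ω, (∀ x ∉ V, ω x = ω₀ x) → kent RB G ω ≤ C * kent (P.gibbsKernel B) G ω := by
    intro ω hω
    have ht : 0 < avg (P.gibbsKernel B) G ω := hGp.avg.pos ω
    refine (kent_le_avg_entDiv hGp ht ω).trans ?_
    rw [kent_eq_avg_entDiv (κ := P.gibbsKernel B) hGp]
    exact (cmpB _ (hGp.entDiv _) (fun ω' => entDiv_nonneg (hGp.pos ω') ht) (hdiv _) ω hω).2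
  have entA : ∀ ω, (∀ x ∉ V, ω x = ω₀ x) → kent RA G ω ≤ C * kent (P.gibbsKernel A) G ω := by
    intro ω hω
    have ht : 0 < avg (P.gibbsKernel A) G ω := hGp.avg.pos ω
    refine (kent_le_avg_entDiv hGp ht ω).trans ?_
    rw [kent_eq_avg_entDiv (κ := P.gibbsKernel A) hGp]
    exact (cmpA _ (hGp.entDiv _) (fun ω' => entDiv_nonneg (hGp.pos ω') ht) (hdiv _) ω hω).2
  have hkB : BddMeas (kent (P.gibbsKernel B) G) := hGp.kent
  have hkA : BddMeas (kent (P.gibbsKernel A) G) := hGp.kent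
  have boundB : avg RA (kent RB G) ω₀
      ≤ C ^ 3 * avg (P.gibbsKernel V) (kent (P.gibbsKernel B) G) ω₀ := by
    have h1 : avg RA (kent RB G) ω₀ ≤ C * avg RA (kent (P.gibbsKernel B) G) ω₀ := by
      rw [← avg_const_mul]
      exact P.avg_frozenKernel_mono hNA hGp.kent ((BddMeas.const C).mul hkB) ω₀ fun ω hω =>
        entB ω fun x hx => hω x fun hxA => hx (hAV hxA)
    have h2 : avg RB (kent (P.gibbsKernel B) G) = kent (P.gibbsKernel B) G := funext fun ω =>
      P.avg_frozenKernel_of_indepOf hNB ω₀ hkB.1 (P.indepOf_kent B G) ω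
    have h3 := lower _ hkB (kent_nonneg hGp) ((P.indepOf_kent B G).mono hNB)
    rw [h2] at h3
    calc _ ≤ C * (C ^ 2 * avg (P.gibbsKernel V) (kent (P.gibbsKernel B) G) ω₀) :=
          h1.trans (mul_le_mul_of_nonneg_left h3 hC0)
      _ = _ := by ring
  have boundA : avg RB (kent RA G) ω₀
      ≤ C ^ 3 * avg (P.gibbsKernel V) (kent (P.gibbsKernel A) G) ω₀ := by
    have h1 : avg RB (kent RA G) ω₀ ≤ C * avg RB (kent (P.gibbsKernel A) G) ω₀ := by
      rw [← avg_const_mul]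
      exact P.avg_frozenKernel_mono hNB hGp.kent ((BddMeas.const C).mul hkA) ω₀ fun ω hω =>
        entA ω fun x hx => hω x fun hxB => hx (hBV hxB)
    have h2 : avg RA (kent (P.gibbsKernel A) G) = kent (P.gibbsKernel A) G := funext fun ω =>
      P.avg_frozenKernel_of_indepOf hNA ω₀ hkA.1 (P.indepOf_kent A G) ω
    have h3 := lower _ hkA (kent_nonneg hGp) ((P.indepOf_kent A G).mono hNA)
    rw [← hcomm' hkA, h2] at h3
    calc _ ≤ C * (C ^ 2 * avg (P.gibbsKernel V) (kent (P.gibbsKernel A) G) ω₀) :=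
          h1.trans (mul_le_mul_of_nonneg_left h3 hC0)
      _ = _ := by ring
  have mainG : kent (P.gibbsKernel V) G ω₀ ≤ C ^ 5 *
      (avg (P.gibbsKernel V) (kent (P.gibbsKernel A) G) ω₀
        + avg (P.gibbsKernel V) (kent (P.gibbsKernel B) G) ω₀) := by
    have ht : 0 < avg (RB ∘ₖ RA) G ω₀ := hGp.avg.pos ω₀
    have h1 : kent (P.gibbsKernel V) G ω₀ ≤ C ^ 2 * kent (RB ∘ₖ RA) G ω₀ := by
      refine (kent_le_avg_entDiv hGp ht ω₀).trans ?_
      rw [kent_eq_avg_entDiv (κ := RB ∘ₖ RA) hGp, ← avg_avg (hGp.entDiv _)]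
      exact upper _ (hGp.entDiv _) (fun ω' => entDiv_nonneg (hGp.pos ω') ht) (hdiv _)
    have h2 : kent (RB ∘ₖ RA) G ω₀ ≤ avg RA (kent RB G) ω₀ + avg RB (kent RA G) ω₀ := by
      rw [kent_comp hGp]
      gcongr
      exact kent_avg_le hcomm.symm (P.isProper_frozenKernel hNA ω₀) hGp ω₀
    calc _ ≤ C ^ 2 * (C ^ 3 * avg (P.gibbsKernel V) (kent (P.gibbsKernel B) G) ω₀
            + C ^ 3 * avg (P.gibbsKernel V) (kent (P.gibbsKernel A) G) ω₀) :=
          h1.trans (mul_le_mul_of_nonneg_left (h2.trans (add_le_add boundB boundA)) (by positivity))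
      _ = _ := by ring
  have chV := kent_chain (P.gibbsKernel_comp_of_subset (hNA.trans hAV)) hF ω₀
  have chA : avg (P.gibbsKernel V) (kent (P.gibbsKernel A) F) ω₀
      = avg (P.gibbsKernel V) (kent (P.gibbsKernel N) F) ω₀
        + avg (P.gibbsKernel V) (kent (P.gibbsKernel A) G) ω₀ := by
    rw [← hVA (hF.kent (κ := P.gibbsKernel N)), ← avg_add hF.kent.avg hkA]
    exact congrArg (fun Φ => avg (P.gibbsKernel V) Φ ω₀)
      (funext fun ω => kent_chain (P.gibbsKernel_comp_of_subset hNA) hF ω)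
  have chB : avg (P.gibbsKernel V) (kent (P.gibbsKernel B) F) ω₀
      = avg (P.gibbsKernel V) (kent (P.gibbsKernel N) F) ω₀
        + avg (P.gibbsKernel V) (kent (P.gibbsKernel B) G) ω₀ := by
    rw [← hVB (hF.kent (κ := P.gibbsKernel N)), ← avg_add hF.kent.avg hkB]
    exact congrArg (fun Φ => avg (P.gibbsKernel V) Φ ω₀)
      (funext fun ω => kent_chain (P.gibbsKernel_comp_of_subset hNB) hF ω)
  have hN0 : 0 ≤ avg (P.gibbsKernel V) (kent (P.gibbsKernel N) F) ω₀ :=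
    avg_nonneg (kent_nonneg hF) ω₀
  have hC5 : 1 ≤ C ^ 5 := one_le_pow₀ hC1
  rw [chV, chA, chB]
  nlinarith

end SpinSystem

/-! ### The recursion over boxes -/

section Lattice

variable {d : ℕ}

lemma evenSites_subset (V : Finset (Site d)) : evenSites V ⊆ V := Finset.filter_subset _ _

lemma oddSites_subset (V : Finset (Site d)) : oddSites V ⊆ V := Finset.filter_subset _ _

lemma evenSites_union (A B : Finset (Site d)) :
    evenSites (A ∪ B) = evenSites A ∪ evenSites B := Finset.filter_union _ _ _

lemma oddSites_union (A B : Finset (Site d)) :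
    oddSites (A ∪ B) = oddSites A ∪ oddSites B := Finset.filter_union _ _ _

lemma evenSites_union_oddSites (V : Finset (Site d)) : evenSites V ∪ oddSites V = V := by
  ext x
  simp only [evenSites, oddSites, Finset.mem_union, Finset.mem_filter, ← and_or_left,
    and_iff_left_iff_imp]
  exact fun _ => Int.even_or_odd _

lemma natAbs_sub_le_latticeDist (x y : Site d) (i : Fin d) :
    (x i - y i).natAbs ≤ latticeDist x y :=
  Finset.single_le_sum (f := fun i => (x i - y i).natAbs) (fun _ _ => Nat.zero_le _)
    (Finset.mem_univ i)

/-- The sites of `V` whose `i`-th coordinate, shifted by `s`, lies in one of the intervals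
`[6 u m, 6 u m + 4 u)`. -/
def slabs (V : Finset (Site d)) (i : Fin d) (u s : ℤ) : Finset (Site d) :=
  V.filter fun x => x i + s - 6 * u * ((x i + s) / (6 * u)) < 4 * u

lemma six_mul_ediv_bounds {u : ℤ} (hu : 0 < u) (t : ℤ) :
    6 * u * (t / (6 * u)) ≤ t ∧ t < 6 * u * (t / (6 * u)) + 6 * u := by
  have h1 := Int.mul_ediv_add_emod t (6 * u)
  have h2 := Int.emod_nonneg t (show 6 * u ≠ 0 by omega)
  have h3 := Int.emod_lt_of_pos t (show 0 < 6 * u by omega)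
  constructor <;> linarith

lemma slabs_union {u : ℤ} (hu : 0 < u) (V : Finset (Site d)) (i : Fin d) :
    slabs V i u 0 ∪ slabs V i u (3 * u) = V := by
  ext x
  simp only [slabs, Finset.mem_union, Finset.mem_filter, ← and_or_left, and_iff_left_iff_imp]
  intro _
  obtain ⟨h1, h2⟩ := six_mul_ediv_bounds hu (x i + 0)
  obtain ⟨h3, h4⟩ := six_mul_ediv_bounds hu (x i + 3 * u)
  set m := (x i + 0) / (6 * u)
  set m' := (x i + 3 * u) / (6 * u)
  by_contra! hcon
  rcases le_or_gt m' m with h | h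
  · nlinarith [hcon.1, hcon.2, mul_le_mul_of_nonneg_left h (show 0 ≤ 6 * u by omega)]
  · nlinarith [hcon.1, hcon.2, mul_le_mul_of_nonneg_left (show m + 1 ≤ m' from h)
      (show 0 ≤ 6 * u by omega)]

lemma le_latticeDist_of_notMem_slabs {u : ℕ} (hu : 0 < u) (V : Finset (Site d)) (i : Fin d)
    {x y : Site d} (hx : x ∈ V \ slabs V i u 0) (hy : y ∈ V \ slabs V i u (3 * u)) :
    u ≤ latticeDist x y := by
  simp only [slabs, Finset.mem_sdiff, Finset.mem_filter, not_and, not_lt] at hx hy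
  have hx' := hx.2 hx.1
  have hy' := hy.2 hy.1
  have hu' : (0 : ℤ) < u := by exact_mod_cast hu
  obtain ⟨h1, h2⟩ := six_mul_ediv_bounds hu' (x i + 0)
  obtain ⟨h3, h4⟩ := six_mul_ediv_bounds hu' (y i + 3 * u)
  refine le_trans ?_ (natAbs_sub_le_latticeDist x y i)
  set m := (x i + 0) / (6 * (u : ℤ))
  set m' := (y i + 3 * u) / (6 * (u : ℤ))
  rcases le_or_gt m' m with h | h
  · have := mul_le_mul_of_nonneg_left h (show 0 ≤ 6 * (u : ℤ) by omega)
    have : (u : ℤ) ≤ x i - y i := by linarith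
    omega
  · have := mul_le_mul_of_nonneg_left (show m + 1 ≤ m' from h) (show 0 ≤ 6 * (u : ℤ) by omega)
    have : (u : ℤ) ≤ y i - x i := by linarith
    omega

/-- Adjacent sites lie in the same slab. -/
lemma ediv_eq_of_mem_slabs {u : ℤ} (hu : 0 < u) {V : Finset (Site d)} {i : Fin d} {s : ℤ}
    {x y : Site d} (hx : x ∈ slabs V i u s) (hy : y ∈ slabs V i u s) (hxy : latticeDist x y = 1) :
    (x i + s) / (6 * u) = (y i + s) / (6 * u) := by
  have hx' := (Finset.mem_filter.1 hx).2
  have hy' := (Finset.mem_filter.1 hy).2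
  have hd := natAbs_sub_le_latticeDist x y i
  rw [hxy] at hd
  obtain ⟨h1, h2⟩ := six_mul_ediv_bounds hu (x i + s)
  obtain ⟨h3, h4⟩ := six_mul_ediv_bounds hu (y i + s)
  set m := (x i + s) / (6 * u)
  set m' := (y i + s) / (6 * u)
  have hd1 : x i - y i ≤ 1 := by omega
  have hd2 : y i - x i ≤ 1 := by omega
  rcases lt_trichotomy m m' with h | h | h
  · have := mul_le_mul_of_nonneg_left (show m + 1 ≤ m' from h) (show 0 ≤ 6 * u by omega)
    linarith
  · exact h
  · have := mul_le_mul_of_nonneg_left (show m' + 1 ≤ m from h) (show 0 ≤ 6 * u by omega)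
    linarith

/-- `V` is contained in a translate of the box with side lengths `b`. -/
def InBox (b : Fin d → ℕ) (V : Finset (Site d)) : Prop :=
  ∃ v : Site d, ∀ x ∈ V, ∀ i, v i ≤ x i ∧ x i < v i + b i

lemma InBox.card_le {b : Fin d → ℕ} {V : Finset (Site d)} (h : InBox b V) {n : ℕ}
    (hb : ∀ i, b i ≤ n) : V.card ≤ n ^ d := by
  obtain ⟨v, hv⟩ := h
  have hsub : V ⊆ Fintype.piFinset fun i => Finset.Ico (v i) (v i + b i) := fun x hx => by
    rw [Fintype.mem_piFinset]
    exact fun i => Finset.mem_Ico.2 (hv x hx i)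
  refine (Finset.card_le_card hsub).trans ?_
  rw [Fintype.card_piFinset]
  refine (Finset.prod_le_prod' (g := fun _ => n) fun i _ => ?_).trans (by simp)
  simpa using hb i

/-- A single slab is short in the direction `i`. -/
lemma InBox.slab {b : Fin d → ℕ} {V : Finset (Site d)} (h : InBox b V) {u : ℕ} (hu : 0 < u)
    (i : Fin d) (s m : ℤ) :
    InBox (Function.update b i (4 * u))
      ((slabs V i u s).filter fun x => (x i + s) / (6 * (u : ℤ)) = m) := by
  obtain ⟨v, hv⟩ := h
  refine ⟨Function.update v i (6 * u * m - s), fun x hx j => ?_⟩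
  obtain ⟨hx1, hxm⟩ := Finset.mem_filter.1 hx
  obtain ⟨hxV, hx2⟩ := Finset.mem_filter.1 hx1
  by_cases hj : j = i
  · subst hj
    have h1 := (six_mul_ediv_bounds (u := u) (by exact_mod_cast hu) (x j + s)).1
    rw [hxm] at h1 hx2
    simp only [Function.update_self]
    push_cast
    constructor <;> linarith
  · simp only [Function.update_of_ne hj]
    exact hv x hxV j

end Lattice

namespace SpinSystem

variable {d : ℕ} {S : Type*} [MeasurableSpace S] (P : SpinSystem S)

/-- The even/odd factorization of the entropy in `V` with constant `1 / C`, for all boundary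
conditions and all functions bounded above and away from zero. -/
def EntFac (V : Finset (Site d)) (C : ℝ) : Prop :=
  ∀ F : (Site d → S) → ℝ, PosBdd F → ∀ ω, kent (P.gibbsKernel V) F ω ≤
    C * (avg (P.gibbsKernel V) (kent (P.gibbsKernel (evenSites V)) F) ω
      + avg (P.gibbsKernel V) (kent (P.gibbsKernel (oddSites V)) F) ω)

variable {P}

lemma avg_gibbsKernel_avg {A V : Finset (Site d)} (h : A ⊆ V) {Φ : (Site d → S) → ℝ}
    (hΦ : BddMeas Φ) : avg (P.gibbsKernel V) (avg (P.gibbsKernel A) Φ)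
      = avg (P.gibbsKernel V) Φ := by
  rw [avg_avg hΦ, P.gibbsKernel_comp_of_subset h]

/-- The mean entropy is monotone in the block. -/
lemma avg_kent_mono {A B V : Finset (Site d)} (hAB : A ⊆ B) (hB : B ⊆ V)
    {F : (Site d → S) → ℝ} (hF : PosBdd F) (ω : Site d → S) :
    avg (P.gibbsKernel V) (kent (P.gibbsKernel A) F) ω
      ≤ avg (P.gibbsKernel V) (kent (P.gibbsKernel B) F) ω := by
  rw [← avg_gibbsKernel_avg hB hF.kent]
  exact avg_mono hF.kent.avg hF.kent
    (fun ω' => avg_kent_le_kent (P.gibbsKernel_comp_of_subset hAB) hF ω') ω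

/-- The exact decomposition of the entropy over two separated blocks. -/
lemma Separated.kent_union {X Y : Finset (Site d)} (h : Separated X Y)
    {F : (Site d → S) → ℝ} (hF : PosBdd F) (ω : Site d → S) :
    kent (P.gibbsKernel (X ∪ Y)) F ω
      = avg (P.gibbsKernel (X ∪ Y)) (kent (P.gibbsKernel X) F) ω
        + avg (P.gibbsKernel (X ∪ Y)) (kent (P.gibbsKernel Y) (avg (P.gibbsKernel X) F)) ω := by
  have hg : PosBdd (avg (P.gibbsKernel X) F) := hF.avg
  rw [kent_chain (P.gibbsKernel_comp_of_subset Finset.subset_union_left) hF,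
    kent_chain (P.gibbsKernel_comp_of_subset
      (Finset.subset_union_right (s₁ := X) (s₂ := Y))) hg, avg_avg hF.bddMeas,
    ← h.gibbsKernel_union,
    P.kent_gibbsKernel_of_indepOf hF.avg (P.indepOf_avg _ F), add_zero]

lemma Separated.avg_kent_union_le {X Y X' Y' : Finset (Site d)} (h : Separated X Y)
    (hX : X' ⊆ X) (hY : Y' ⊆ Y) {F : (Site d → S) → ℝ} (hF : PosBdd F) (ω : Site d → S) :
    avg (P.gibbsKernel (X ∪ Y)) (kent (P.gibbsKernel X') F) ω
        + avg (P.gibbsKernel (X ∪ Y)) (kent (P.gibbsKernel Y') (avg (P.gibbsKernel X) F)) ω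
      ≤ avg (P.gibbsKernel (X ∪ Y)) (kent (P.gibbsKernel (X' ∪ Y')) F) ω := by
  have hg : PosBdd (avg (P.gibbsKernel X') F) := hF.avg
  have hsub : X' ∪ Y' ⊆ X ∪ Y := Finset.union_subset_union hX hY
  -- averaging over the rest of `X` commutes with resampling `Y'` and so decreases the entropy
  have h1 : avg (P.gibbsKernel (X ∪ Y)) (kent (P.gibbsKernel Y') (avg (P.gibbsKernel X) F)) ω
      ≤ avg (P.gibbsKernel (X ∪ Y)) (kent (P.gibbsKernel Y') (avg (P.gibbsKernel X') F)) ω := by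
    rw [← avg_gibbsKernel_avg (A := X) Finset.subset_union_left
      (hg.kent (κ := P.gibbsKernel Y')), ← avg_gibbsKernel_avg (P := P) hX hF.bddMeas]
    exact avg_mono hg.avg.kent hg.kent.avg (fun ω' => kent_avg_le
      ((h.mono (Finset.Subset.refl X) hY).gibbsKernel_comm P) (P.isProper_gibbsKernel Y') hg ω') ω
  have h2 : avg (P.gibbsKernel (X ∪ Y)) (kent (P.gibbsKernel (X' ∪ Y')) F) ω
      = avg (P.gibbsKernel (X ∪ Y)) (kent (P.gibbsKernel X') F) ω
        + avg (P.gibbsKernel (X ∪ Y)) (kent (P.gibbsKernel Y') (avg (P.gibbsKernel X') F)) ω := by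
    rw [← avg_gibbsKernel_avg hsub (hF.kent (κ := P.gibbsKernel X')),
      ← avg_gibbsKernel_avg hsub (hg.kent (κ := P.gibbsKernel Y')),
      ← avg_add hF.kent.avg hg.kent.avg]
    exact congrArg (fun Φ => avg (P.gibbsKernel (X ∪ Y)) Φ ω)
      (funext fun ω' => (h.mono hX hY).kent_union hF ω')
  rw [h2]
  gcongr

lemma EntFac.mono {V : Finset (Site d)} {C C' : ℝ} (h : P.EntFac V C) (hC : C ≤ C') :
    P.EntFac V C' := by
  intro F hF ω
  refine (h F hF ω).trans (mul_le_mul_of_nonneg_right hC ?_)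
  exact add_nonneg (avg_nonneg (kent_nonneg hF) ω) (avg_nonneg (kent_nonneg hF) ω)

/-- The factorization passes from a region to a larger one, in the mean. -/
lemma EntFac.avg_kent_le {A V : Finset (Site d)} {C : ℝ} (h : P.EntFac A C) (hA : A ⊆ V)
    {F : (Site d → S) → ℝ} (hF : PosBdd F) (ω : Site d → S) :
    avg (P.gibbsKernel V) (kent (P.gibbsKernel A) F) ω ≤
      C * (avg (P.gibbsKernel V) (kent (P.gibbsKernel (evenSites A)) F) ω
        + avg (P.gibbsKernel V) (kent (P.gibbsKernel (oddSites A)) F) ω) := by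
  rw [← avg_gibbsKernel_avg hA (hF.kent (κ := P.gibbsKernel (evenSites A))),
    ← avg_gibbsKernel_avg hA (hF.kent (κ := P.gibbsKernel (oddSites A))),
    ← avg_add hF.kent.avg hF.kent.avg, ← avg_const_mul]
  exact avg_mono hF.kent ((BddMeas.const C).mul (hF.kent.avg.add hF.kent.avg)) (h F hF) ω

/-- Tensorization: the factorization constant of a union of separated regions is not worse than
those of the parts. -/
lemma EntFac.union {X Y : Finset (Site d)} {C : ℝ} (hC : 0 ≤ C) (h : Separated X Y)
    (hX : P.EntFac X C) (hY : P.EntFac Y C) : P.EntFac (X ∪ Y) C := by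
  intro F hF ω
  have hg : PosBdd (avg (P.gibbsKernel X) F) := hF.avg
  have h1 := hX.avg_kent_le (V := X ∪ Y) Finset.subset_union_left hF ω
  have h2 := hY.avg_kent_le (V := X ∪ Y) Finset.subset_union_right hg ω
  have h3 := mul_le_mul_of_nonneg_left
    (h.avg_kent_union_le (evenSites_subset X) (evenSites_subset Y) (P := P) hF ω) hC
  have h4 := mul_le_mul_of_nonneg_left
    (h.avg_kent_union_le (oddSites_subset X) (oddSites_subset Y) (P := P) hF ω) hC
  rw [h.kent_union hF, evenSites_union, oddSites_union]
  linarith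

lemma entFac_empty {C : ℝ} (hC : 0 ≤ C) : P.EntFac (d := d) ∅ C := by
  intro F hF ω
  rw [P.kent_gibbsKernel_of_indepOf hF fun ω ω' h => by
    rw [show ω = ω' from funext fun x => h x (Finset.notMem_empty x)]]
  exact mul_nonneg hC (add_nonneg (avg_nonneg (kent_nonneg hF) ω)
    (avg_nonneg (kent_nonneg hF) ω))

lemma EntFac.of_fibers {V : Finset (Site d)} {C : ℝ} (hC : 0 ≤ C) (f : Site d → ℤ)
    (hf : ∀ x ∈ V, ∀ y ∈ V, latticeDist x y = 1 → f x = f y)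
    (h : ∀ m, P.EntFac (V.filter fun x => f x = m) C) : P.EntFac V C := by
  have key : ∀ T : Finset ℤ, P.EntFac (V.filter fun x => f x ∈ T) C := by
    intro T
    induction T using Finset.induction with
    | empty => simpa using entFac_empty hC
    | insert m T hm ih =>
      have e : (V.filter fun x => f x ∈ insert m T)
          = (V.filter fun x => f x = m) ∪ V.filter fun x => f x ∈ T := by
        rw [← Finset.filter_or]
        simp only [Finset.mem_insert]
      rw [e]
      refine EntFac.union hC (fun x hx y hy => ?_) (h m) ih
      rw [Finset.mem_filter] at hx hy
      have hne : f x ≠ f y := fun hxy => hm (by rw [← hx.2, hxy]; exact hy.2)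
      exact ⟨fun hxy => hne (by rw [hxy]), fun hxy => hne (hf x hx.1 y hy.1 hxy)⟩
  have := key (V.image f)
  rwa [Finset.filter_true_of_mem fun x hx => Finset.mem_image_of_mem f hx] at this

/-- The factorization with a constant that depends on the region only through its cardinality. -/
lemma SM.entFac_of_card_le {K a : ℝ} (hK : 0 ≤ K) (ha : 0 ≤ a) (h : P.SM d K a)
    {V : Finset (Site d)} {n : ℕ} (hV : V.card ≤ n) : P.EntFac V (((1 + K) ^ n) ^ 5) := by
  have h1 : P.EntFac V (((1 + K) ^ V.card) ^ 5) := fun F hF ω => by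
    simpa using P.kent_le_of_overlap hK ha (evenSites_union_oddSites V) (h _) (h _) (r := 0)
      (fun _ _ _ _ => Nat.zero_le _) hF ω
  refine h1.mono (pow_le_pow_left₀ (by positivity) ?_ 5)
  exact pow_le_pow_right₀ (by linarith) hV

/-- One step of the recursion: a region is covered by two overlapping families of slabs, which are
short in the direction `i`. This costs a constant factor only, whatever the number of slabs. -/
lemma SM.entFac_of_slabs {K a : ℝ} (hK : 0 ≤ K) (ha : 0 ≤ a) (h : P.SM d K a)
    {u n : ℕ} (hu : 0 < u) (hmix : ((1 + K * Real.exp (-a * u)) ^ n ^ d) ^ 5 ≤ 4)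
    {b : Fin d → ℕ} (hb : ∀ i, b i ≤ n) {C : ℝ} (hC : 0 ≤ C) (i : Fin d)
    (hstep : ∀ V : Finset (Site d), InBox (Function.update b i (4 * u)) V → P.EntFac V C)
    {V : Finset (Site d)} (hV : InBox b V) : P.EntFac V (8 * C) := by
  have hu' : (0 : ℤ) < u := by exact_mod_cast hu
  have hslab : ∀ s : ℤ, P.EntFac (slabs V i u s) C := fun s =>
    EntFac.of_fibers hC (fun x => (x i + s) / (6 * (u : ℤ)))
      (fun x hx y hy hxy => ediv_eq_of_mem_slabs hu' hx hy hxy)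
      fun m => hstep _ (hV.slab hu i s m)
  have hq : ((1 + K * Real.exp (-a * u)) ^ V.card) ^ 5 ≤ 4 := by
    have := Real.exp_pos (-a * u)
    refine le_trans (pow_le_pow_left₀ (by positivity) ?_ 5) hmix
    exact pow_le_pow_right₀ (by nlinarith) (hV.card_le hb)
  intro F hF ω
  have hsub : ∀ s : ℤ, slabs V i u s ⊆ V := fun s => Finset.filter_subset _ _
  have h0 := P.kent_le_of_overlap hK ha (slabs_union hu' V i) (h _) (h _) (r := u)
    (fun x hx y hy => le_latticeDist_of_notMem_slabs hu V i hx hy) hF ω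
  have hs : ∀ s : ℤ, avg (P.gibbsKernel V) (kent (P.gibbsKernel (slabs V i u s)) F) ω ≤
      C * (avg (P.gibbsKernel V) (kent (P.gibbsKernel (evenSites V)) F) ω
        + avg (P.gibbsKernel V) (kent (P.gibbsKernel (oddSites V)) F) ω) := fun s => by
    refine ((hslab s).avg_kent_le (hsub s) hF ω).trans (mul_le_mul_of_nonneg_left ?_ hC)
    exact add_le_add
      (avg_kent_mono (Finset.filter_subset_filter _ (hsub s)) (evenSites_subset V) hF ω)
      (avg_kent_mono (Finset.filter_subset_filter _ (hsub s)) (oddSites_subset V) hF ω)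
  have hn : ∀ s : ℤ, 0 ≤ avg (P.gibbsKernel V) (kent (P.gibbsKernel (slabs V i u s)) F) ω :=
    fun s => avg_nonneg (kent_nonneg hF) ω
  have h1 := mul_le_mul_of_nonneg_right hq (add_nonneg (hn 0) (hn (3 * u)))
  linarith [hs 0, hs (3 * u)]

/-- From cubes of side `4 u` to cubes of side `n`, one coordinate at a time. -/
lemma SM.entFac_cube_step {K a : ℝ} (hK : 0 ≤ K) (ha : 0 ≤ a) (h : P.SM d K a)
    {u n : ℕ} (hu : 0 < u) (hun : 4 * u ≤ n)
    (hmix : ((1 + K * Real.exp (-a * u)) ^ n ^ d) ^ 5 ≤ 4) {C : ℝ} (hC : 0 ≤ C)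
    (hstep : ∀ V : Finset (Site d), InBox (fun _ => 4 * u) V → P.EntFac V C)
    {V : Finset (Site d)} (hV : InBox (fun _ => n) V) : P.EntFac V (8 ^ d * C) := by
  have key : ∀ (T : Finset (Fin d)) (V : Finset (Site d)),
      InBox (fun i => if i ∈ T then n else 4 * u) V → P.EntFac V (8 ^ T.card * C) := by
    intro T
    induction T using Finset.induction with
    | empty => simpa using hstep
    | insert i T hi ih =>
      intro V hV
      rw [Finset.card_insert_of_notMem hi, pow_succ', mul_assoc]
      refine h.entFac_of_slabs hK ha hu hmix (fun j => ?_) (by positivity) i (fun W hW => ih W ?_) hV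
      · split_ifs
        · exact le_rfl
        · exact hun
      · convert hW using 1
        funext j
        by_cases hj : j = i
        · subst hj
          simp [hi]
        · simp [hj]
  simpa using key Finset.univ V (by simpa using hV)

/-- The recursion over scales: the constant grows by `8 ^ d` when the side length grows by the
factor `M`. -/
lemma SM.entFac_cube {K a : ℝ} (hK : 0 ≤ K) (ha : 0 ≤ a) (h : P.SM d K a) {M u₀ : ℕ}
    (hM : 1 ≤ M) (hu₀ : 0 < u₀)
    (hmix : ∀ u : ℕ, u₀ ≤ u → ((1 + K * Real.exp (-a * u)) ^ (4 * M * u) ^ d) ^ 5 ≤ 4) (j : ℕ) :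
    ∀ V : Finset (Site d), InBox (fun _ => 4 * (u₀ * M ^ j)) V →
      P.EntFac V ((8 ^ d) ^ j * ((1 + K) ^ (4 * u₀) ^ d) ^ 5) := by
  induction j with
  | zero =>
    intro V hV
    rw [pow_zero, mul_one] at hV
    rw [pow_zero, one_mul]
    exact h.entFac_of_card_le hK ha (hV.card_le fun _ => le_rfl)
  | succ j ih =>
    intro V hV
    have hle : u₀ ≤ u₀ * M ^ j := Nat.le_mul_of_pos_right _ (by positivity)
    rw [pow_succ', mul_assoc]
    refine h.entFac_cube_step hK ha (u := u₀ * M ^ j) (n := 4 * M * (u₀ * M ^ j))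
      (by positivity) ?_ (hmix _ hle) (by positivity) ih ?_
    · calc 4 * (u₀ * M ^ j) ≤ M * (4 * (u₀ * M ^ j)) := Nat.le_mul_of_pos_left _ hM
        _ = _ := by ring
    · convert hV using 2
      ring

end SpinSystem

/-! ### From bounded functions to the class `f log⁺ f ∈ L¹` -/

section Truncation

open Filter Topology

/-- Truncation of `x ≥ 0` to a value between `1 / (n + 1)` and `n + 1`. -/
def clamp (n : ℕ) (x : ℝ) : ℝ := min x n + 1 / ((n : ℝ) + 1)

/-- An integrable majorant of `y log y` for all truncations `y` of `x`. -/
def logBound (x : ℝ) : ℝ := 7 + 3 * (x * Real.posLog x)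

lemma clamp_nonneg {x : ℝ} (hx : 0 ≤ x) (n : ℕ) : 0 ≤ clamp n x :=
  add_nonneg (le_min hx (Nat.cast_nonneg n)) (by positivity)

lemma clamp_le (x : ℝ) (n : ℕ) : clamp n x ≤ x + 1 := by
  refine add_le_add (min_le_left _ _) ?_
  rw [div_le_one (by positivity)]
  linarith [Nat.cast_nonneg (α := ℝ) n]

lemma tendsto_clamp (x : ℝ) : Tendsto (fun n => clamp n x) atTop (𝓝 x) := by
  have h1 : Tendsto (fun n : ℕ => min x (n : ℝ)) atTop (𝓝 x) := by
    refine tendsto_const_nhds.congr' ?_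
    filter_upwards [eventually_ge_atTop ⌈x⌉₊] with n hn
    exact (min_eq_left ((Nat.le_ceil x).trans (by exact_mod_cast hn))).symm
  simpa [clamp] using h1.add (tendsto_one_div_add_atTop_nhds_zero_nat (𝕜 := ℝ))

lemma mul_posLog_nonneg {x : ℝ} (hx : 0 ≤ x) : 0 ≤ x * Real.posLog x :=
  mul_nonneg hx Real.posLog_nonneg

lemma le_three_add_mul_posLog {x : ℝ} (hx : 0 ≤ x) : x ≤ 3 + x * Real.posLog x := by
  rcases le_or_gt x 3 with h | h
  · linarith [mul_posLog_nonneg hx]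
  · have h1 : 1 ≤ Real.log x := by
      rw [Real.le_log_iff_exp_le (by linarith)]
      linarith [Real.exp_one_lt_d9]
    have h2 : Real.log x ≤ Real.posLog x := le_max_right _ _
    nlinarith

lemma le_logBound {x : ℝ} (hx : 0 ≤ x) : x + 1 ≤ logBound x := by
  have := le_three_add_mul_posLog hx
  have := mul_posLog_nonneg hx
  unfold logBound
  linarith

lemma one_le_logBound {x : ℝ} (hx : 0 ≤ x) : 1 ≤ logBound x := by
  linarith [le_logBound hx]

lemma neg_one_le_mul_log {y : ℝ} (hy : 0 ≤ y) : -1 ≤ y * Real.log y := by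
  rcases hy.eq_or_lt with rfl | hy
  · simp
  · have h := entDiv_nonneg hy (Real.exp_pos (-1))
    rw [entDiv, Real.log_exp] at h
    linarith [Real.exp_le_one_iff.2 (show (-1 : ℝ) ≤ 0 by norm_num)]

lemma abs_mul_log_le {x y : ℝ} (hx : 0 ≤ x) (hy : 0 ≤ y) (hyx : y ≤ x + 1) :
    |y * Real.log y| ≤ logBound x := by
  refine abs_le.2 ⟨by linarith [neg_one_le_mul_log hy, one_le_logBound hx], ?_⟩
  have h1 : Real.log y ≤ Real.posLog (x + 1) :=
    (le_max_right _ _).trans (Real.posLog_le_posLog hy hyx)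
  have h2 : Real.posLog (x + 1) ≤ 1 + Real.posLog x := by
    have := Real.posLog_add (x := x) (y := 1)
    rw [Real.posLog_one, add_zero] at this
    linarith [Real.log_two_lt_d9]
  have h3 : Real.posLog x ≤ x :=
    max_le hx (Real.log_le_self hx)
  have h4 : 0 ≤ Real.posLog x := Real.posLog_nonneg
  calc y * Real.log y ≤ y * (1 + Real.posLog x) :=
        mul_le_mul_of_nonneg_left (h1.trans h2) hy
    _ ≤ (x + 1) * (1 + Real.posLog x) := mul_le_mul_of_nonneg_right hyx (by linarith)
    _ ≤ logBound x := by
        have := le_three_add_mul_posLog hx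
        unfold logBound
        linarith

variable {Ω : Type*} [MeasurableSpace Ω]

lemma posBdd_clamp {F : Ω → ℝ} (hF : Measurable F) (h0 : ∀ ω, 0 ≤ F ω) (n : ℕ) :
    PosBdd fun ω => clamp n (F ω) := by
  refine ⟨(hF.min measurable_const).add measurable_const, ⟨1 / ((n : ℝ) + 1), by positivity,
    fun ω => ?_⟩, n + 1 / ((n : ℝ) + 1), fun ω => ?_⟩
  · exact le_add_of_nonneg_left (le_min (h0 ω) (Nat.cast_nonneg n))
  · exact add_le_add (min_le_right _ _) le_rfl

section Measure

variable {μ : Measure Ω} {F : Ω → ℝ}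

lemma integrable_of_logBound (hF : Measurable F) (h0 : ∀ ω, 0 ≤ F ω)
    (hD : Integrable (fun ω => logBound (F ω)) μ) : Integrable F μ :=
  hD.mono' hF.aestronglyMeasurable (Eventually.of_forall fun ω => by
    rw [Real.norm_eq_abs, abs_of_nonneg (h0 ω)]
    linarith [le_logBound (h0 ω)])

lemma integrable_mul_log_of_logBound (hF : Measurable F) (h0 : ∀ ω, 0 ≤ F ω)
    (hD : Integrable (fun ω => logBound (F ω)) μ) :
    Integrable (fun ω => F ω * Real.log (F ω)) μ :=
  hD.mono' (hF.mul hF.log).aestronglyMeasurable (Eventually.of_forall fun ω =>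
    abs_mul_log_le (h0 ω) (h0 ω) (by linarith))

lemma tendsto_integral_clamp (hF : Measurable F) (h0 : ∀ ω, 0 ≤ F ω)
    (hD : Integrable (fun ω => logBound (F ω)) μ) :
    Tendsto (fun n => ∫ ω, clamp n (F ω) ∂μ) atTop (𝓝 (∫ ω, F ω ∂μ)) :=
  tendsto_integral_of_dominated_convergence (fun ω => logBound (F ω))
    (fun n => (posBdd_clamp hF h0 n).1.aestronglyMeasurable) hD
    (fun n => Eventually.of_forall fun ω => by
      rw [Real.norm_eq_abs, abs_of_nonneg (clamp_nonneg (h0 ω) n)]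
      exact (clamp_le _ n).trans (le_logBound (h0 ω)))
    (Eventually.of_forall fun ω => tendsto_clamp _)

lemma tendsto_integral_clamp_mul_log (hF : Measurable F) (h0 : ∀ ω, 0 ≤ F ω)
    (hD : Integrable (fun ω => logBound (F ω)) μ) :
    Tendsto (fun n => ∫ ω, clamp n (F ω) * Real.log (clamp n (F ω)) ∂μ) atTop
      (𝓝 (∫ ω, F ω * Real.log (F ω) ∂μ)) :=
  tendsto_integral_of_dominated_convergence (fun ω => logBound (F ω))
    (fun n => (posBdd_clamp hF h0 n).mul_log.1.aestronglyMeasurable) hD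
    (fun n => Eventually.of_forall fun ω =>
      abs_mul_log_le (h0 ω) (clamp_nonneg (h0 ω) n) (clamp_le _ n))
    (Eventually.of_forall fun ω =>
      (Real.continuous_mul_log.tendsto _).comp (tendsto_clamp (F ω)))

lemma entropy_eq (hF : Measurable F) (h0 : ∀ ω, 0 ≤ F ω)
    (hD : Integrable (fun ω => logBound (F ω)) μ) :
    SpinSystem.entropy μ F
      = ∫ ω, F ω * Real.log (F ω) ∂μ - (∫ ω, F ω ∂μ) * Real.log (∫ ω, F ω ∂μ) := by
  have hi := integrable_of_logBound hF h0 hD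
  unfold SpinSystem.entropy
  by_cases hs : ∫ ω, F ω ∂μ = 0
  · have hz : F =ᵐ[μ] 0 := (integral_eq_zero_iff_of_nonneg h0 hi).1 hs
    have hz' : (fun ω => F ω * Real.log (F ω)) =ᵐ[μ] 0 := by
      filter_upwards [hz] with ω hω
      simp [hω]
    rw [hs, integral_congr_ae hz']
    simp
  · rw [← integral_mul_const, ← integral_sub (integrable_mul_log_of_logBound hF h0 hD)
      (hi.mul_const _)]
    refine integral_congr_ae (Eventually.of_forall fun ω => ?_)
    by_cases hω : F ω = 0
    · simp [hω]
    · simp only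
      rw [Real.log_div hω hs, mul_sub]

lemma entropy_map {Ω' : Type*} [MeasurableSpace Ω'] {ν : Measure Ω'} {g : Ω' → Ω}
    (hg : Measurable g) (hF : Measurable F) :
    SpinSystem.entropy (ν.map g) F = SpinSystem.entropy ν fun ω => F (g ω) := by
  have hm : ∀ s : ℝ, Measurable fun ω => F ω * Real.log (F ω / s) := fun s =>
    hF.mul (hF.div_const s).log
  unfold SpinSystem.entropy
  rw [integral_map hg.aemeasurable hF.aestronglyMeasurable, integral_map hg.aemeasurable
    (hm _).aestronglyMeasurable]

end Measure

variable {κ η : Kernel Ω Ω} {F : Ω → ℝ}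

lemma tendsto_kent_clamp (hF : Measurable F) (h0 : ∀ ω, 0 ≤ F ω) {ω : Ω}
    (hD : Integrable (fun ω' => logBound (F ω')) (κ ω)) :
    Tendsto (fun n => kent κ (fun ω' => clamp n (F ω')) ω) atTop
      (𝓝 (SpinSystem.entropy (κ ω) F)) := by
  rw [entropy_eq hF h0 hD]
  exact (tendsto_integral_clamp_mul_log hF h0 hD).sub
    ((Real.continuous_mul_log.tendsto _).comp (tendsto_integral_clamp hF h0 hD))

variable [IsMarkovKernel κ] [IsMarkovKernel η]

lemma abs_avg_clamp_mul_log_le (hF : Measurable F) (h0 : ∀ ω, 0 ≤ F ω) {ω : Ω}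
    (hD : Integrable (fun ω' => logBound (F ω')) (η ω)) (n : ℕ) :
    |avg η (fun ω' => clamp n (F ω')) ω * Real.log (avg η (fun ω' => clamp n (F ω')) ω)|
      ≤ ∫ ω', logBound (F ω') ∂η ω := by
  have hc := posBdd_clamp hF h0 n
  have h1 : (1 : ℝ) ≤ ∫ ω', logBound (F ω') ∂η ω := by
    have := integral_mono (μ := η ω) (integrable_const 1) hD fun ω' => one_le_logBound (h0 ω')
    simpa using this
  refine abs_le.2 ⟨by linarith [neg_one_le_mul_log ((hc.avg (κ := η)).pos ω).le], ?_⟩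
  have h2 := kent_nonneg (κ := η) hc ω
  have h3 : avg η (fun ω' => clamp n (F ω') * Real.log (clamp n (F ω'))) ω
      ≤ ∫ ω', logBound (F ω') ∂η ω :=
    integral_mono (hc.mul_log.integrable _) hD fun ω' =>
      (abs_le.1 (abs_mul_log_le (h0 ω') (clamp_nonneg (h0 ω') n) (clamp_le _ n))).2
  unfold kent at h2
  linarith

/-- Integrability of the conditional entropy, and its approximation by the entropies of the
truncations. -/
lemma integrable_entropy_and_tendsto (hcomp : η ∘ₖ κ = κ) (hF : Measurable F)
    (h0 : ∀ ω, 0 ≤ F ω) {ω : Ω} (hD : Integrable (fun ω' => logBound (F ω')) (κ ω)) :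
    Integrable (fun ω' => SpinSystem.entropy (η ω') F) (κ ω) ∧
      Tendsto (fun n => avg κ (kent η fun ω' => clamp n (F ω')) ω) atTop
        (𝓝 (∫ ω', SpinSystem.entropy (η ω') F ∂κ ω)) := by
  have hD' : Integrable (fun ω' => logBound (F ω')) ((η ∘ₖ κ) ω) := by rwa [hcomp]
  have hae : ∀ᵐ ω' ∂κ ω, Integrable (fun ω'' => logBound (F ω'')) (η ω') := hD'.ae_of_comp
  have hDη : Integrable (fun ω' => ∫ ω'', logBound (F ω'') ∂η ω') (κ ω) := hD'.integral_comp
  have hψ := integrable_mul_log_of_logBound hF h0 hD'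
  have hψη : Integrable (fun ω' => ∫ ω'', F ω'' * Real.log (F ω'') ∂η ω') (κ ω) :=
    hψ.integral_comp
  have hmη : Measurable fun ω' => ∫ ω'', F ω'' ∂η ω' :=
    (hF.stronglyMeasurable.integral_kernel (κ := η)).measurable
  have hlim : ∀ᵐ ω' ∂κ ω, Tendsto (fun n => avg η (fun ω'' => clamp n (F ω'')) ω' *
      Real.log (avg η (fun ω'' => clamp n (F ω'')) ω')) atTop
      (𝓝 ((∫ ω'', F ω'' ∂η ω') * Real.log (∫ ω'', F ω'' ∂η ω'))) := by
    filter_upwards [hae] with ω' hω'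
    exact (Real.continuous_mul_log.tendsto _).comp (tendsto_integral_clamp hF h0 hω')
  have hbd : ∀ n, ∀ᵐ ω' ∂κ ω, ‖avg η (fun ω'' => clamp n (F ω'')) ω' *
      Real.log (avg η (fun ω'' => clamp n (F ω'')) ω')‖ ≤ ∫ ω'', logBound (F ω'') ∂η ω' :=
    fun n => hae.mono fun ω' hω' => abs_avg_clamp_mul_log_le hF h0 hω' n
  have hφη : Integrable (fun ω' => (∫ ω'', F ω'' ∂η ω') * Real.log (∫ ω'', F ω'' ∂η ω'))
      (κ ω) := by
    refine hDη.mono' (hmη.mul hmη.log).aestronglyMeasurable ?_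
    filter_upwards [hlim, ae_all_iff.2 hbd] with ω' h1 h2
    exact le_of_tendsto h1.norm (Eventually.of_forall h2)
  have hent : (fun ω' => SpinSystem.entropy (η ω') F) =ᵐ[κ ω]
      fun ω' => (∫ ω'', F ω'' * Real.log (F ω'') ∂η ω')
        - (∫ ω'', F ω'' ∂η ω') * Real.log (∫ ω'', F ω'' ∂η ω') :=
    hae.mono fun ω' hω' => entropy_eq hF h0 hω'
  refine ⟨(hψη.sub hφη).congr hent.symm, ?_⟩
  rw [integral_congr_ae hent, integral_sub hψη hφη, ← Kernel.integral_comp hψ, hcomp]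
  have e : ∀ n, avg κ (kent η fun ω' => clamp n (F ω')) ω
      = avg κ (fun ω' => clamp n (F ω') * Real.log (clamp n (F ω'))) ω
        - avg κ (fun ω' => avg η (fun ω'' => clamp n (F ω'')) ω' *
          Real.log (avg η (fun ω'' => clamp n (F ω'')) ω')) ω := by
    intro n
    have hc := posBdd_clamp hF h0 n
    conv_rhs => rw [← hcomp, ← avg_avg hc.mul_log, hcomp]
    exact avg_sub hc.mul_log.avg hc.avg.mul_log ω
  simp only [e]
  exact (tendsto_integral_clamp_mul_log hF h0 hD).sub
    (tendsto_integral_of_dominated_convergence _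
      (fun n => (posBdd_clamp hF h0 n).avg.mul_log.1.aestronglyMeasurable) hDη hbd hlim)

end Truncation

namespace SpinSystem

variable {d : ℕ} {S : Type*} [MeasurableSpace S] {P : SpinSystem S}

/-- The factorization for bounded functions extends to all `f` with `f log⁺ f` integrable. -/
lemma EntFac.entropy_le {V : Finset (Site d)} {C : ℝ} (h : P.EntFac V C) (τ : Site d → S)
    {f : (V → S) → ℝ} (hf : Measurable f) (h0 : ∀ σ, 0 ≤ f σ)
    (hi : Integrable (fun σ => f σ * Real.posLog (f σ)) (P.gibbs V τ)) :
    entropy (P.gibbs V τ) f ≤ C * ∫ σ, (P.blockEntropy V (evenSites V) τ f σ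
      + P.blockEntropy V (oddSites V) τ f σ) ∂P.gibbs V τ := by
  have hr : Measurable fun (ω : Site d → S) (x : V) => ω x :=
    measurable_pi_iff.2 fun x => measurable_pi_apply _
  set F : (Site d → S) → ℝ := fun ω => f fun x => ω x with hFdef
  have hF : Measurable F := hf.comp hr
  have hF0 : ∀ ω, 0 ≤ F ω := fun ω => h0 _
  have hFp : ∀ σ : V → S, F (patch V τ σ) = f σ := fun σ => by
    simp only [hFdef]
    congr 1
    exact funext fun x => patch_of_mem _ _ x.2
  have hD : Integrable (fun ω => logBound (F ω)) (P.gibbsKernel V τ) := by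
    have hm : Measurable fun ω => logBound (F ω) := by
      have hpl : Measurable fun ω => Real.posLog (F ω) := measurable_const.max hF.log
      exact measurable_const.add ((hF.mul hpl).const_mul 3)
    rw [gibbsKernel_apply, integrable_map_measure hm.aestronglyMeasurable
      (measurable_patch V τ).aemeasurable]
    refine Integrable.congr ((integrable_const (7 : ℝ)).add (hi.const_mul 3))
      (Filter.Eventually.of_forall fun σ => ?_)
    simp [logBound, hFp]
  have hblock : ∀ A : Finset (Site d), ∀ σ, P.blockEntropy V A τ f σ
      = entropy (P.gibbsKernel A (patch V τ σ)) F := fun A σ =>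
    (entropy_map (measurable_patch A _) hF).symm
  have hV : entropy (P.gibbs V τ) f = entropy (P.gibbsKernel V τ) F := by
    rw [gibbsKernel_apply, entropy_map (measurable_patch V τ) hF]
    simp only [hFp]
  obtain ⟨iE, tE⟩ := integrable_entropy_and_tendsto
    (P.gibbsKernel_comp_of_subset (evenSites_subset V)) hF hF0 hD
  obtain ⟨iO, tO⟩ := integrable_entropy_and_tendsto
    (P.gibbsKernel_comp_of_subset (oddSites_subset V)) hF hF0 hD
  have hrhs : ∫ σ, (P.blockEntropy V (evenSites V) τ f σ
      + P.blockEntropy V (oddSites V) τ f σ) ∂P.gibbs V τ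
      = ∫ ω, entropy (P.gibbsKernel (evenSites V) ω) F ∂P.gibbsKernel V τ
        + ∫ ω, entropy (P.gibbsKernel (oddSites V) ω) F ∂P.gibbsKernel V τ := by
    rw [← integral_add iE iO]
    simp only [hblock]
    exact (integral_map (measurable_patch V τ).aemeasurable
      (iE.add iO).aestronglyMeasurable).symm
  rw [hV, hrhs]
  exact le_of_tendsto_of_tendsto' (tendsto_kent_clamp hF hF0 hD) ((tE.add tO).const_mul C)
    fun n => h _ (posBdd_clamp hF hF0 n) τ

end SpinSystem

/-! ### Choice of the scales -/

section Scales

open Filter Topology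

/-- The mixing factors on large scales are bounded. -/
lemma exists_mixing_scale (d M : ℕ) {K a : ℝ} (hK : 0 < K) (ha : 0 < a) :
    ∃ u₀ : ℕ, 0 < u₀ ∧ ∀ u : ℕ, u₀ ≤ u →
      ((1 + K * Real.exp (-a * u)) ^ (4 * M * u) ^ d) ^ 5 ≤ 4 := by
  have h1 : Tendsto (fun u : ℕ => 5 * K * (4 * M / a) ^ d *
      ((a * u) ^ d * Real.exp (-(a * u)))) atTop (𝓝 0) := by
    have h2 : Tendsto (fun u : ℕ => a * (u : ℝ)) atTop atTop :=
      tendsto_natCast_atTop_atTop.const_mul_atTop ha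
    simpa using ((Real.tendsto_pow_mul_exp_neg_atTop_nhds_zero d).comp h2).const_mul
      (5 * K * (4 * M / a) ^ d)
  obtain ⟨u₀, hu₀⟩ := eventually_atTop.1 (h1.eventually (ge_mem_nhds zero_lt_one))
  refine ⟨max u₀ 1, by positivity, fun u hu => ?_⟩
  have h3 := hu₀ u ((le_max_left _ _).trans hu)
  set x := K * Real.exp (-a * u) with hx
  have hx0 : 0 ≤ x := by positivity
  calc ((1 + x) ^ (4 * M * u) ^ d) ^ 5
      ≤ ((Real.exp x) ^ (4 * M * u) ^ d) ^ 5 := by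
        gcongr
        linarith [Real.add_one_le_exp x]
    _ = Real.exp (5 * (((4 * M * u) ^ d : ℕ) * x)) := by
        rw [← Real.exp_nat_mul, ← Real.exp_nat_mul]
        norm_num
    _ ≤ Real.exp 1 := by
        refine Real.exp_le_exp.2 (le_trans (le_of_eq ?_) h3)
        rw [hx, neg_mul]
        push_cast
        rw [mul_pow, mul_pow, mul_pow, div_pow, mul_pow]
        field_simp
    _ ≤ 4 := by linarith [Real.exp_one_lt_d9]

/-- A scale factor `M` for which the loss `8 ^ d` per scale is at most `M ^ ε`. -/
lemma exists_scale_factor (d : ℕ) {ε : ℝ} (hε : 0 < ε) :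
    ∃ M : ℕ, 2 ≤ M ∧ (8 : ℝ) ^ d ≤ (M : ℝ) ^ ε := by
  refine ⟨⌈((8 : ℝ) ^ d) ^ (1 / ε)⌉₊ + 2, by omega, ?_⟩
  have h1 : ((8 : ℝ) ^ d) ^ (1 / ε) ≤ ((⌈((8 : ℝ) ^ d) ^ (1 / ε)⌉₊ + 2 : ℕ) : ℝ) := by
    push_cast
    linarith [Nat.le_ceil (((8 : ℝ) ^ d) ^ (1 / ε))]
  calc (8 : ℝ) ^ d = (((8 : ℝ) ^ d) ^ (1 / ε)) ^ ε := by
        rw [← Real.rpow_mul (by positivity), one_div_mul_cancel hε.ne', Real.rpow_one]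
    _ ≤ _ := Real.rpow_le_rpow (by positivity) h1 hε.le

lemma one_le_scale (d k : ℕ) : 1 ≤ SpinSystem.scale d k :=
  Real.one_le_rpow (by norm_num) (by positivity)

lemma tendsto_scale {d : ℕ} (hd : 1 ≤ d) : Tendsto (SpinSystem.scale d) atTop atTop := by
  have hd' : (0 : ℝ) < d := by exact_mod_cast hd
  exact (tendsto_rpow_atTop_of_base_gt_one _ (by norm_num)).comp
    (tendsto_natCast_atTop_atTop.atTop_div_const hd')

/-- The regions of the `k`-th class fit into cubes of side comparable to `ℓ_k`. -/
lemma inBox_of_inClass {d k n : ℕ} (hd : 1 ≤ d) {V : Finset (Site d)}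
    (hV : SpinSystem.InClass k V) (hn : 3 / 2 * SpinSystem.scale d k + 1 ≤ n) :
    InBox (fun _ => n) V := by
  obtain ⟨π, v, hv⟩ := hV
  have hd' : (0 : ℝ) < d := by exact_mod_cast hd
  refine ⟨fun j => -v (π.symm j), fun x hx j => ?_⟩
  obtain ⟨h1, h2⟩ := hv x hx (π.symm j)
  rw [Equiv.apply_symm_apply] at h1 h2
  have h3 : SpinSystem.scale d (k + ((π.symm j : ℕ) + 1)) ≤ 3 / 2 * SpinSystem.scale d k := by
    unfold SpinSystem.scale
    rw [← Real.rpow_one_add' (by norm_num) (by positivity)]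
    refine Real.rpow_le_rpow_of_exponent_le (by norm_num) ?_
    rw [div_le_iff₀ hd', add_mul, div_mul_cancel₀ _ hd'.ne', one_mul]
    have : (((π.symm j : ℕ) + 1 : ℕ) : ℝ) ≤ d := by exact_mod_cast (π.symm j).2
    push_cast at this ⊢
    linarith
  have h4 : x j + v (π.symm j) < n := by
    have : ((x j + v (π.symm j) : ℤ) : ℝ) < ((n : ℤ) : ℝ) := by
      push_cast at h2 ⊢
      linarith
    exact_mod_cast this
  constructor <;> linarith

end Scales

end

theorem theorem4p7 (d : ℕ) (hd : 1 ≤ d) (K a ε : ℝ) (hK : 0 < K) (ha : 0 < a) (hε : 0 < ε) :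
    ∃ k₀ : ℕ, ∀ (S : Type*) [MeasurableSpace S] (P : SpinSystem S), P.SM d K a →
      ∀ k : ℕ, k₀ ≤ k →
        ENNReal.ofReal ((SpinSystem.scale d k) ^ (-ε)) ≤ P.factorizationConstant d k := by
  obtain ⟨M, hM2, hM⟩ := exists_scale_factor d (half_pos hε)
  obtain ⟨u₀, hu₀, hmix⟩ := exists_mixing_scale d M hK ha
  have hM0 : (1 : ℝ) < M := by exact_mod_cast hM2
  set C₀ : ℝ := ((1 + K) ^ (4 * u₀) ^ d) ^ 5 with hC₀
  -- half of the exponent pays for the recursion, the other half for the constants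
  have hev : ∀ᶠ k in Filter.atTop,
      (M : ℝ) ^ (ε / 2) * C₀ ≤ SpinSystem.scale d k ^ (ε / 2) :=
    ((tendsto_rpow_atTop (half_pos hε)).comp (tendsto_scale hd)).eventually_ge_atTop _
  obtain ⟨k₀, hk₀⟩ := Filter.eventually_atTop.1 hev
  refine ⟨k₀, fun S _ P hP k hk => ?_⟩
  set ℓ := SpinSystem.scale d k with hℓ
  have hℓ1 : 1 ≤ ℓ := one_le_scale d k
  have hℓ0 : 0 < ℓ := one_pos.trans_le hℓ1
  -- the number of scales between `u₀` and `ℓ`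
  obtain ⟨j, hj1, hj2⟩ : ∃ j : ℕ, ℓ ≤ (M : ℝ) ^ j ∧ (M : ℝ) ^ j ≤ M * ℓ := by
    obtain ⟨n, hn1, hn2⟩ := exists_nat_pow_near hℓ1 hM0
    exact ⟨n + 1, hn2.le, by rw [pow_succ']; gcongr⟩
  have hloss : (8 ^ d) ^ j * C₀ ≤ ℓ ^ ε := by
    calc (8 ^ d) ^ j * C₀ ≤ ((M : ℝ) ^ (ε / 2)) ^ j * C₀ := by gcongr
      _ = ((M : ℝ) ^ j) ^ (ε / 2) * C₀ := by
          rw [← Real.rpow_natCast ((M : ℝ) ^ (ε / 2)), ← Real.rpow_mul (by positivity),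
            mul_comm (ε / 2), Real.rpow_mul (by positivity), Real.rpow_natCast]
      _ ≤ (M * ℓ) ^ (ε / 2) * C₀ := by gcongr
      _ = ℓ ^ (ε / 2) * ((M : ℝ) ^ (ε / 2) * C₀) := by
          rw [Real.mul_rpow (by positivity) hℓ0.le]
          ring
      _ ≤ ℓ ^ (ε / 2) * ℓ ^ (ε / 2) := by
          gcongr
          exact hk₀ k hk
      _ = ℓ ^ ε := by
          rw [← Real.rpow_add hℓ0, add_halves]
  refine le_sSup ⟨ℓ ^ (-ε), ⟨by positivity, fun V hV τ f hf hf0 hfi => ?_⟩, rfl⟩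
  have hbox : InBox (fun _ => 4 * (u₀ * M ^ j)) V := by
    refine inBox_of_inClass hd hV ?_
    have hu1 : (1 : ℝ) ≤ u₀ := by exact_mod_cast hu₀
    push_cast
    nlinarith
  have hfac : P.EntFac V (ℓ ^ ε) :=
    (hP.entFac_cube hK.le ha.le (by omega) hu₀ hmix j V hbox).mono hloss
  have hmain := hfac.entropy_le τ hf hf0 hfi
  rw [Real.rpow_neg hℓ0.le, inv_mul_le_iff₀ (by positivity)]
  exact hmain
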